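/- A \emph{plane tree} is a finite tree drawn on the oriented sphere (equivalently, a map on the sphere with a single face), considered up to orientation-preserving homeomorphism. A \emph{leaf} is a vertex of degree $1$; a plane tree is \emph{leaf-rooted} if one of its leaves is distinguished as the root. (Equivalently, a leaf-rooted plane tree is a rooted plane tree with linearly ordered subtrees at every vertex, whose root has exactly one child.) For a set $S$ of positive integers, a tree is \emph{$S$-valent} if the degree of each of its vertices belongs to $S$. Let $\Delta$ be a nonempty, finite or infinite, set of integers $\delta\ge 3$, and let $p$ be the greatest common divisor of $\{\delta-2:\delta\in\Delta\}$. Let $T_\Delta(n)$ be the number of leaf-rooted $(\Delta\cup\{1\})$-valent plane trees with exactly $n$ non-root leaves. (a) The number of non-root leaves of every leaf-rooted $(\Delta\cup\{1\})$-valent plane tree is congruent to $1$ modulo $p$. (b) There are unique positive real numbers $\tau_\Delta,\rho_\Delta,\gamma_\Delta$ such that the following sums converge and $$\sum_{\delta\in\Delta}(\delta-1)\,\tau_\Delta^{\delta-2}=1,\qquad \rho_\Delta=\tau_\Delta-\sum_{\delta\in\Delta}\tau_\Delta^{\delta-1},\qquad \gamma_\Delta=\sqrt{\frac{2\rho_\Delta}{\sum_{\delta\in\Delta}(\delta-1)(\delta-2)\,\tau_\Delta^{\delta-3}}},$$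 and, as $n\to\infty$, $$T_\Delta(np+1)=\frac{p\,\gamma_\Delta}{2\sqrt{\pi}}\,(np+1)^{-3/2}\,\rho_\Delta^{-(np+1)}\left(1+O\!\left(n^{-1}\right)\right),$$ where the implied constant may depend on $\Delta$. -/

import Mathlib

/-- Rooted plane trees: a root vertex together with an ordered tuple of `k ≥ 0` rooted plane trees,
its subtrees listed from left to right. These are the finite trees drawn on the oriented sphere
(maps on the sphere with a single face), with a root-vertex and a first edge at the root-vertex,
up to homeomorphism. Every constructor `node` inside a term is one vertex of the tree. -/
inductive PlaneTree : Type where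
  | node : (k : ℕ) → (Fin k → PlaneTree) → PlaneTree

namespace PlaneTree

/-- The degree of the root-vertex. -/
def rootDegree : PlaneTree → ℕ
  | node k _ => k

/-- The multiset of the degrees of all vertices of a tree that hangs from one more edge, attached
to its root: a vertex with `k` children has degree `k + 1`. -/
def hangingDegrees : PlaneTree → Multiset ℕ
  | node k f => (k + 1) ::ₘ ∑ i, hangingDegrees (f i)

/-- The multiset of the degrees of all vertices other than the root-vertex. -/
def nonRootDegrees : PlaneTree → Multiset ℕ
  | node _ f => ∑ i, hangingDegrees (f i)

/-- The multiset of the degrees of all vertices. -/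
def degrees (t : PlaneTree) : Multiset ℕ :=
  t.rootDegree ::ₘ t.nonRootDegrees

/-- The degree of every vertex belongs to `S`. -/
def IsValent (S : Set ℕ) (t : PlaneTree) : Prop :=
  ∀ d ∈ t.degrees, d ∈ S

/-- The root-vertex is a leaf, that is, a vertex of degree one. -/
def IsLeafRooted (t : PlaneTree) : Prop :=
  t.rootDegree = 1

/-- The number of leaves other than the root-vertex. -/
def numNonRootLeaves (t : PlaneTree) : ℕ :=
  t.nonRootDegrees.count 1

/-- The set of leaf-rooted `(Δ ∪ {1})`-valent plane trees with `n` non-root leaves. -/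
def leafRootedTrees (Δ : Set ℕ) (n : ℕ) : Set PlaneTree :=
  {t | t.IsLeafRooted ∧ t.IsValent (Δ ∪ {1}) ∧ t.numNonRootLeaves = n}

/-- The number of leaf-rooted `(Δ ∪ {1})`-valent plane trees with `n` non-root leaves. -/
noncomputable def treeCount (Δ : Set ℕ) (n : ℕ) : ℕ :=
  (leafRootedTrees Δ n).ncard

/-- `τ`, `ρ`, `γ` are positive and satisfy `∑ (δ - 1) τ ^ (δ - 2) = 1`, `ρ = τ - ∑ τ ^ (δ - 1)` and
`γ = √(2 ρ / ∑ (δ - 1) (δ - 2) τ ^ (δ - 3))`, the sums being over `δ ∈ Δ` and convergent.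
(The exponents are natural numbers, and `Δ` is meant to have no element below three.) -/
structure IsTreeConstants (Δ : Set ℕ) (τ ρ γ : ℝ) : Prop where
  tau_pos : 0 < τ
  rho_pos : 0 < ρ
  gamma_pos : 0 < γ
  tau_eq : HasSum (fun δ : Δ => ((δ : ℝ) - 1) * τ ^ ((δ : ℕ) - 2)) 1
  rho_eq : ∃ s : ℝ, HasSum (fun δ : Δ => τ ^ ((δ : ℕ) - 1)) s ∧ ρ = τ - s
  gamma_eq : ∃ s : ℝ,
    HasSum (fun δ : Δ => ((δ : ℝ) - 1) * ((δ : ℝ) - 2) * τ ^ ((δ : ℕ) - 3)) s ∧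
      γ = √(2 * ρ / s)

end PlaneTree

/-!
Let `F k n` count the ordered forests of `k` trees with `n` leaves. Splitting the first tree at its
root gives a recursion for `F`. With `z = w - ∑ w ^ (δ - 1)`, the coefficient of `z ^ n` in `w ^ k`
is a Cauchy integral over a circle around `0`, which satisfies the same recursion. Integrating by
parts turns the case of one tree into `n * T(n) = (2π)⁻¹ ∮ w / z ^ n dθ`, and the circle may have
radius `τ`. There the minimum `ρ` of `|z|` is attained exactly at the `p` points with
`w ^ p = τ ^ p`, which are critical points of `z`. When `n ≡ 1 [MOD p]` they contribute equally by
rotational symmetry, and Laplace's method evaluates the contribution of `τ`; the relative error is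
`O(1 / n)` and not only `O(1 / √n)` because the first-order correction is odd in `θ`.
-/

theorem hasSum_ncard_iUnion {ι α : Type*} {s : ι → Set α}
    (hs : Pairwise (Function.onFun Disjoint s)) (hfin : (⋃ i, s i).Finite) :
    HasSum (fun i => (s i).ncard) (⋃ i, s i).ncard := by
  obtain ⟨hsfin, hne⟩ := (Set.finite_iUnion_iff hs).1 hfin
  have hunion : ⋃ i, s i = ⋃ i ∈ {i | (s i).Nonempty}, s i := by
    simp only [Set.mem_ofPred_eq, Set.iUnion_nonempty_self]
  rw [hunion, hne.ncard_biUnion (fun i _ => hsfin i) (hs.set_pairwise _),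
    finsum_mem_eq_finite_toFinset_sum _ hne]
  refine hasSum_sum_of_ne_finset_zero fun i hi => ?_
  rw [Set.Finite.mem_toFinset, Set.mem_ofPred_eq, Set.not_nonempty_iff_eq_empty] at hi
  rw [hi, Set.ncard_empty]

namespace PlaneTree

variable {Δ : Set ℕ} {p : ℕ}

/-- A plane tree is the same as the list of the subtrees at its root, from left to right. -/
def children : PlaneTree ≃ List PlaneTree where
  toFun | node _ f => List.ofFn f
  invFun l := node l.length l.get
  left_inv := fun ⟨k, f⟩ => by
    have h := List.equivSigmaTuple.right_inv ⟨k, f⟩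
    simp only [List.equivSigmaTuple, Sigma.mk.injEq] at h
    exact (node.injEq ..).mpr h
  right_inv := List.ofFn_get

theorem rootDegree_eq_length_children (t : PlaneTree) : t.rootDegree = t.children.length := by
  obtain ⟨k, f⟩ := t
  exact List.length_ofFn.symm

theorem nonRootDegrees_eq_sum_children (t : PlaneTree) :
    t.nonRootDegrees = (t.children.map hangingDegrees).sum := by
  obtain ⟨k, f⟩ := t
  simp only [nonRootDegrees, children, Equiv.coe_fn_mk, List.map_ofFn, List.sum_ofFn,
    Function.comp_apply]

theorem hangingDegrees_eq_cons (t : PlaneTree) :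
    t.hangingDegrees = (t.children.length + 1) ::ₘ (t.children.map hangingDegrees).sum := by
  rw [← nonRootDegrees_eq_sum_children, ← rootDegree_eq_length_children]
  obtain ⟨k, f⟩ := t
  rfl

theorem children_induction {P : PlaneTree → Prop} (h : ∀ t, (∀ s ∈ t.children, P s) → P t)
    (t : PlaneTree) : P t := by
  induction t with
  | node k f ih => exact h _ ((List.forall_mem_ofFn_iff).2 ih)

/-- The number of leaves of a tree that hangs from one more edge, attached to its root. -/
def hangingLeaves (t : PlaneTree) : ℕ := t.hangingDegrees.count 1

/-- The degree of every vertex belongs to `S` once the tree hangs from one more edge, attached to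
its root. -/
def IsHangingValent (S : Set ℕ) (t : PlaneTree) : Prop := ∀ d ∈ t.hangingDegrees, d ∈ S

theorem count_sum_hangingDegrees (l : List PlaneTree) :
    (l.map hangingDegrees).sum.count 1 = (l.map hangingLeaves).sum := by
  rw [← Multiset.coe_countAddMonoidHom, map_list_sum, List.map_map]
  rfl

theorem hangingLeaves_eq (t : PlaneTree) :
    t.hangingLeaves = (t.children.map hangingLeaves).sum + if t.children = [] then 1 else 0 := by
  rw [hangingLeaves, hangingDegrees_eq_cons, Multiset.count_cons, count_sum_hangingDegrees]
  simp only [right_eq_add, List.length_eq_zero_iff]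

theorem forall_mem_sum_hangingDegrees {S : Set ℕ} (l : List PlaneTree) :
    (∀ d ∈ (l.map hangingDegrees).sum, d ∈ S) ↔ ∀ t ∈ l, t.IsHangingValent S := by
  induction l with
  | nil => simp
  | cons t l ih =>
    rw [List.map_cons, List.sum_cons, List.forall_mem_cons, ← ih, IsHangingValent]
    simp only [Multiset.mem_add, or_imp, forall_and]

theorem isHangingValent_iff {S : Set ℕ} (t : PlaneTree) :
    t.IsHangingValent S ↔ t.children.length + 1 ∈ S ∧ ∀ s ∈ t.children, s.IsHangingValent S := by
  rw [IsHangingValent, hangingDegrees_eq_cons, Multiset.forall_mem_cons,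
    forall_mem_sum_hangingDegrees]

theorem isValent_iff {S : Set ℕ} (t : PlaneTree) :
    t.IsValent S ↔ t.children.length ∈ S ∧ ∀ s ∈ t.children, s.IsHangingValent S := by
  rw [IsValent, degrees, Multiset.forall_mem_cons, rootDegree_eq_length_children,
    nonRootDegrees_eq_sum_children, forall_mem_sum_hangingDegrees]

theorem numNonRootLeaves_eq_sum_children (t : PlaneTree) :
    t.numNonRootLeaves = (t.children.map hangingLeaves).sum := by
  rw [numNonRootLeaves, nonRootDegrees_eq_sum_children, count_sum_hangingDegrees]

theorem length_le_sum_hangingLeaves_of_pos {l : List PlaneTree}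
    (h : ∀ t ∈ l, 0 < t.hangingLeaves) : l.length ≤ (l.map hangingLeaves).sum := by
  have hone : ∀ n ∈ l.map hangingLeaves, 1 ≤ n := List.forall_mem_map.2 h
  simpa only [List.length_map] using List.length_le_sum_of_one_le _ hone

theorem hangingLeaves_pos (t : PlaneTree) : 0 < t.hangingLeaves := by
  induction t using children_induction with
  | h t ih =>
    have hle := length_le_sum_hangingLeaves_of_pos ih
    rw [hangingLeaves_eq]
    split_ifs with h
    · exact Nat.succ_pos _
    · exact (List.length_pos_iff.2 h).trans_le hle

theorem length_le_sum_hangingLeaves (l : List PlaneTree) :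
    l.length ≤ (l.map hangingLeaves).sum :=
  length_le_sum_hangingLeaves_of_pos fun t _ => t.hangingLeaves_pos

theorem sum_hangingLeaves_modEq {l : List PlaneTree}
    (h : ∀ t ∈ l, t.hangingLeaves ≡ 1 [MOD p]) : (l.map hangingLeaves).sum ≡ l.length [MOD p] := by
  induction l with
  | nil => rfl
  | cons t l ih =>
    rw [List.forall_mem_cons] at h
    rw [List.map_cons, List.sum_cons, List.length_cons, add_comm]
    exact (ih h.2).add h.1

theorem hangingLeaves_modEq (hΔ : ∀ δ ∈ Δ, 3 ≤ δ) (hp : ∀ δ ∈ Δ, p ∣ δ - 2) {t : PlaneTree}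
    (ht : t.IsHangingValent (Δ ∪ {1})) : t.hangingLeaves ≡ 1 [MOD p] := by
  induction t using children_induction with
  | h t ih =>
    rw [isHangingValent_iff] at ht
    have hsum := sum_hangingLeaves_modEq fun s hs => ih s hs (ht.2 s hs)
    rw [hangingLeaves_eq]
    rcases ht.1 with hdeg | hdeg
    · have hlen := hΔ _ hdeg
      rw [if_neg (List.length_pos_iff.1 (by omega)), add_zero]
      exact hsum.trans ((Nat.modEq_iff_dvd' (by omega)).2 (by simpa using hp _ hdeg)).symm
    · simp only [Set.mem_singleton_iff, Nat.add_eq_right, List.length_eq_zero_iff] at hdeg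
      simp only [hdeg, List.map_nil, List.sum_nil, if_true, zero_add]
      rfl

theorem numNonRootLeaves_modEq (hΔ : ∀ δ ∈ Δ, 3 ≤ δ) (hp : ∀ δ ∈ Δ, p ∣ δ - 2) {t : PlaneTree}
    (hroot : t.IsLeafRooted) (ht : t.IsValent (Δ ∪ {1})) : t.numNonRootLeaves ≡ 1 [MOD p] := by
  rw [IsLeafRooted, rootDegree_eq_length_children] at hroot
  rw [numNonRootLeaves_eq_sum_children, ← hroot]
  exact sum_hangingLeaves_modEq fun s hs =>
    hangingLeaves_modEq hΔ hp (((isValent_iff t).1 ht).2 s hs)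

/-- The ordered forests of `k` trees with `n` leaves in total, in which every tree hangs from one
more edge and all degrees belong to `Δ ∪ {1}`. -/
def forests (Δ : Set ℕ) (k n : ℕ) : Set (List PlaneTree) :=
  {l | l.length = k ∧ (∀ t ∈ l, t.IsHangingValent (Δ ∪ {1})) ∧ (l.map hangingLeaves).sum = n}

/-- The number of forests of `k` trees with `n` leaves in total. -/
noncomputable def forestCount (Δ : Set ℕ) (k n : ℕ) : ℕ := (forests Δ k n).ncard

theorem treeCount_eq_forestCount (Δ : Set ℕ) (n : ℕ) : treeCount Δ n = forestCount Δ 1 n := by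
  have himage : leafRootedTrees Δ n = children ⁻¹' forests Δ 1 n := by
    ext t
    simp only [leafRootedTrees, forests, Set.mem_ofPred_eq, Set.mem_preimage, IsLeafRooted,
      rootDegree_eq_length_children, isValent_iff, numNonRootLeaves_eq_sum_children]
    refine and_congr_right fun hlen => and_congr_left' (and_iff_right ?_)
    exact hlen ▸ Or.inr rfl
  rw [treeCount, forestCount, himage,
    Set.ncard_preimage_of_injective_subset_range children.injective
      (by simp only [children.range_eq_univ, Set.subset_univ])]

theorem forests_eq_empty_of_lt {k n : ℕ} (h : n < k) : forests Δ k n = ∅ := by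
  refine Set.eq_empty_of_forall_notMem ?_
  rintro l ⟨rfl, -, rfl⟩
  exact h.not_ge (length_le_sum_hangingLeaves l)

theorem forests_zero_zero : forests Δ 0 0 = {[]} := by
  ext l
  simp +contextual [forests, List.length_eq_zero_iff]

theorem forests_zero_succ (n : ℕ) : forests Δ 0 (n + 1) = ∅ := by
  refine Set.eq_empty_of_forall_notMem ?_
  rintro l ⟨hlen, -, hsum⟩
  simp [List.length_eq_zero_iff.1 hlen] at hsum

theorem forest_induction {P : ℕ → ℕ → Prop} (of_lt : ∀ k n, n < k → P k n) (zero_zero : P 0 0)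
    (zero_succ : ∀ n, P 0 (n + 1))
    (succ_succ : ∀ k n, P k n → (∀ j, 1 < j → P (k + j) (n + 1)) → P (k + 1) (n + 1)) (k n : ℕ) :
    P k n := by
  induction n generalizing k with
  | zero => exact k.casesOn zero_zero fun k => of_lt _ _ k.succ_pos
  | succ n ihn =>
    induction hd : n + 2 - k using Nat.strong_induction_on generalizing k with
    | _ d ihd =>
      rcases k with _ | k
      · exact zero_succ n
      rcases lt_or_ge (n + 1) (k + 1) with hlt | hle
      · exact of_lt _ _ hlt
      · exact succ_succ k n (ihn k) fun j hj => ihd _ (by omega) _ rfl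

/-- The forest obtained by joining the first `j` trees of a forest at a new root. -/
def graft (j : ℕ) (l : List PlaneTree) : List PlaneTree := children.symm (l.take j) :: l.drop j

theorem graft_inj {i j : ℕ} {l m : List PlaneTree} (hi : i ≤ l.length) (hj : j ≤ m.length) :
    graft i l = graft j m ↔ i = j ∧ l = m := by
  refine ⟨fun h => ?_, fun h => by rw [h.1, h.2]⟩
  obtain ⟨htake, hdrop⟩ := List.cons.inj h
  rw [children.symm.injective.eq_iff] at htake
  have hlen := congrArg List.length htake
  rw [List.length_take_of_le hi, List.length_take_of_le hj] at hlen
  exact ⟨hlen, by rw [← List.take_append_drop i l, htake, hdrop, List.take_append_drop]⟩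

theorem exists_graft_eq {l : List PlaneTree} (hl : l ≠ []) :
    ∃ j m, j ≤ m.length ∧ graft j m = l := by
  obtain ⟨t, l, rfl⟩ := List.exists_cons_of_ne_nil hl
  refine ⟨t.children.length, t.children ++ l, by simp, ?_⟩
  rw [graft, List.take_left, List.drop_left, Equiv.symm_apply_apply]

theorem sum_hangingLeaves_graft (j : ℕ) (l : List PlaneTree) :
    ((graft j l).map hangingLeaves).sum =
      (l.map hangingLeaves).sum + if l.take j = [] then 1 else 0 := by
  rw [graft, List.map_cons, List.sum_cons, hangingLeaves_eq, Equiv.apply_symm_apply, add_right_comm,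
    ← List.sum_append, ← List.map_append, List.take_append_drop]

theorem forall_mem_graft {j : ℕ} {l : List PlaneTree} (hj : j ≤ l.length) (S : Set ℕ) :
    (∀ t ∈ graft j l, t.IsHangingValent S) ↔ j + 1 ∈ S ∧ ∀ t ∈ l, t.IsHangingValent S := by
  rw [graft, List.forall_mem_cons, isHangingValent_iff, Equiv.apply_symm_apply,
    List.length_take_of_le hj, and_assoc, ← List.forall_mem_append, List.take_append_drop]

theorem graft_mem_forests_iff (hΔ : ∀ δ ∈ Δ, 3 ≤ δ) {j k n : ℕ} {l : List PlaneTree}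
    (hj : j ≤ l.length) : graft j l ∈ forests Δ (k + 1) (n + 1) ↔
      (j = 0 ∧ l ∈ forests Δ k n) ∨ (j + 1 ∈ Δ ∧ l ∈ forests Δ (k + j) (n + 1)) := by
  have hlen : (graft j l).length = k + 1 ↔ l.length = k + j := by
    rw [graft, List.length_cons, List.length_drop]
    omega
  have hnil : l.take j = [] ↔ j = 0 := by
    rw [← List.length_eq_zero_iff, List.length_take_of_le hj]
  simp only [forests, Set.mem_ofPred_eq, hlen, forall_mem_graft hj, sum_hangingLeaves_graft, hnil,
    Set.mem_union, Set.mem_singleton_iff, Nat.add_eq_right]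
  rcases Nat.eq_zero_or_pos j with rfl | hpos
  · have h1 : 1 ∉ Δ := fun h => absurd (hΔ 1 h) (by norm_num)
    simp [h1]
  · simp only [hpos.ne', or_false, false_and, false_or, if_false, add_zero]
    tauto

theorem forests_succ_succ (hΔ : ∀ δ ∈ Δ, 3 ≤ δ) (k n : ℕ) :
    forests Δ (k + 1) (n + 1) = graft 0 '' forests Δ k n ∪
      ⋃ δ : Δ, graft (δ - 1) '' forests Δ (k + (δ - 1)) (n + 1) := by
  have hsucc : ∀ δ : Δ, (δ : ℕ) - 1 + 1 = δ := fun δ => by have := hΔ δ δ.2; omega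
  refine Set.Subset.antisymm (fun l hl => ?_) (Set.union_subset ?_ (Set.iUnion_subset fun δ => ?_))
  · obtain ⟨j, m, hj, rfl⟩ := exists_graft_eq (List.ne_nil_of_length_eq_add_one hl.1)
    rcases (graft_mem_forests_iff hΔ hj).1 hl with ⟨rfl, hm⟩ | ⟨hjΔ, hm⟩
    · exact Or.inl ⟨m, hm, rfl⟩
    · exact Or.inr (Set.mem_iUnion.2 ⟨⟨j + 1, hjΔ⟩, m, hm, rfl⟩)
  · rintro _ ⟨m, hm, rfl⟩
    exact (graft_mem_forests_iff hΔ (Nat.zero_le _)).2 (Or.inl ⟨rfl, hm⟩)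
  · rintro _ ⟨m, hm, rfl⟩
    refine (graft_mem_forests_iff hΔ ?_).2 (Or.inr ⟨(hsucc δ).symm ▸ δ.2, hm⟩)
    exact hm.1 ▸ Nat.le_add_left _ _

theorem finite_forests (hΔ : ∀ δ ∈ Δ, 3 ≤ δ) (k n : ℕ) : (forests Δ k n).Finite := by
  induction k, n using forest_induction with
  | of_lt k n h => simp only [forests_eq_empty_of_lt h, Set.finite_empty]
  | zero_zero => simp only [forests_zero_zero, Set.finite_singleton]
  | zero_succ n => simp only [forests_zero_succ, Set.finite_empty]
  | succ_succ k n ihleaf ihgraft =>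
    rw [forests_succ_succ hΔ]
    have hsmall : {δ : Δ | (δ : ℕ) ≤ n + 2}.Finite :=
      (Set.finite_Iic (n + 2)).preimage Subtype.val_injective.injOn
    refine (ihleaf.image _).union (hsmall.iUnion (fun δ _ => ?_) fun δ hδ => ?_)
    · have hthree := hΔ δ δ.2
      exact (ihgraft _ (by omega)).image _
    · rw [Set.mem_ofPred_eq] at hδ
      rw [forests_eq_empty_of_lt (by omega), Set.image_empty]

theorem ncard_image_graft {j k n : ℕ} (hj : j ≤ k) :
    (graft j '' forests Δ k n).ncard = forestCount Δ k n :=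
  Set.InjOn.ncard_image fun _ hl _ hm h => ((graft_inj (hl.1 ▸ hj) (hm.1 ▸ hj)).1 h).2

theorem disjoint_image_graft {i j k l m n : ℕ} (hi : i ≤ k) (hj : j ≤ l) (hij : i ≠ j) :
    Disjoint (graft i '' forests Δ k m) (graft j '' forests Δ l n) := by
  refine Set.disjoint_left.2 ?_
  rintro _ ⟨f, hf, rfl⟩ ⟨g, hg, h⟩
  exact hij ((graft_inj (hg.1 ▸ hj) (hf.1 ▸ hi)).1 h).1.symm

/-- Count the forests by the first tree: it is a single leaf, or its root has `δ - 1` children. -/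
theorem hasSum_forestCount (hΔ : ∀ δ ∈ Δ, 3 ≤ δ) (k n : ℕ) :
    HasSum (fun δ : Δ => (forestCount Δ (k + (δ - 1)) (n + 1) : ℂ))
      (forestCount Δ (k + 1) (n + 1) - forestCount Δ k n) := by
  have hfin := finite_forests hΔ (k + 1) (n + 1)
  rw [forests_succ_succ hΔ, Set.finite_union] at hfin
  have hdisj : Pairwise (Function.onFun Disjoint
      fun δ : Δ => graft (δ - 1) '' forests Δ (k + (δ - 1)) (n + 1)) := fun δ ε hne => by
    have hδ := hΔ δ δ.2
    have hε := hΔ ε ε.2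
    have := Subtype.coe_injective.ne hne
    exact disjoint_image_graft (Nat.le_add_left _ _) (Nat.le_add_left _ _) (by omega)
  have hcount : forestCount Δ (k + 1) (n + 1) = forestCount Δ k n +
      (⋃ δ : Δ, graft (δ - 1) '' forests Δ (k + (δ - 1)) (n + 1)).ncard := by
    rw [forestCount, forests_succ_succ hΔ, Set.ncard_union_eq _ hfin.1 hfin.2,
      ncard_image_graft k.zero_le]
    refine Set.disjoint_iUnion_right.2 fun δ => ?_
    have hδ := hΔ δ δ.2
    exact disjoint_image_graft k.zero_le (Nat.le_add_left _ _) (by omega)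
  have hsum := (hasSum_ncard_iUnion hdisj hfin.2).map (Nat.castAddMonoidHom ℂ)
    continuous_of_discreteTopology
  simp only [Function.comp_def, ncard_image_graft (Nat.le_add_left _ _)] at hsum
  rw [hcount]
  simpa using hsum

end PlaneTree

open Metric Filter Topology

theorem circleAverage_sub_smul_deriv_eq_zero {E : Type*} [NormedAddCommGroup E] [NormedSpace ℂ E]
    [CompleteSpace E] {f f' : ℂ → E} {c : ℂ} {R : ℝ} (hR : 0 < R)
    (hf : ∀ w ∈ sphere c R, HasDerivAt f (f' w) w) :
    Real.circleAverage (fun w => (w - c) • f' w) c R = 0 := by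
  rw [Real.circleAverage_eq_circleIntegral hR.ne',
    circleIntegral.integral_congr hR.le (g := f') fun w hw => ?_,
    circleIntegral.integral_eq_zero_of_hasDerivWithinAt' fun w hw => (hf w ?_).hasDerivWithinAt,
    smul_zero]
  · rwa [abs_of_pos hR] at hw
  · exact inv_smul_smul₀ (sub_ne_zero.2 (ne_of_mem_sphere hw hR.ne')) _

theorem hasSum_circleAverage {ι E : Type*} [Countable ι] [NormedAddCommGroup E] [NormedSpace ℝ E]
    {F : ι → ℂ → E} {G : ℂ → E} {u : ι → ℝ} {c : ℂ} {R : ℝ}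
    (hF : ∀ i, ContinuousOn (F i) (sphere c |R|)) (hu : Summable u)
    (hle : ∀ i, ∀ w ∈ sphere c |R|, ‖F i w‖ ≤ u i)
    (hG : ∀ w ∈ sphere c |R|, HasSum (fun i => F i w) (G w)) :
    HasSum (fun i => Real.circleAverage (F i) c R) (Real.circleAverage G c R) := by
  refine HasSum.const_smul _ (intervalIntegral.hasSum_integral_of_dominated_convergence
    (fun i _ => u i) (fun i => ?_) (fun i => ?_) ?_ intervalIntegrable_const ?_)
  · exact ((hF i).comp_continuous (continuous_circleMap c R)
      (circleMap_mem_sphere' c R)).aestronglyMeasurable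
  · exact Eventually.of_forall fun θ _ => hle i _ (circleMap_mem_sphere' c R θ)
  · exact Eventually.of_forall fun _ _ => hu
  · exact Eventually.of_forall fun θ _ => hG _ (circleMap_mem_sphere' c R θ)

section LacunarySeries

variable {ι : Type*} {c : ι → ℂ} {e : ι → ℕ} {w : ℂ}

theorem norm_mul_pow_le_of_mem_ball (i : ι) {R : ℝ} (hw : w ∈ ball 0 R) :
    ‖c i * w ^ e i‖ ≤ ‖c i‖ * R ^ e i := by
  rw [mem_ball_zero_iff] at hw
  rw [norm_mul, norm_pow]
  gcongr

theorem differentiableAt_tsum_mul_pow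
    (hs : ∀ R : ℝ, 0 ≤ R → R < 1 → Summable fun i => ‖c i‖ * R ^ e i) (hw : ‖w‖ < 1) :
    DifferentiableAt ℂ (fun w => ∑' i, c i * w ^ e i) w := by
  obtain ⟨R, hwR, hR⟩ := exists_between hw
  exact (Complex.differentiableOn_tsum_of_summable_norm (hs R ((norm_nonneg w).trans hwR.le) hR)
    (fun i => ((differentiable_pow _).const_mul _).differentiableOn) isOpen_ball
    fun i _ => norm_mul_pow_le_of_mem_ball i).differentiableAt
      (isOpen_ball.mem_nhds (mem_ball_zero_iff.2 hwR))

theorem hasSum_deriv_tsum_mul_pow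
    (hs : ∀ R : ℝ, 0 ≤ R → R < 1 → Summable fun i => ‖c i‖ * R ^ e i) (hw : ‖w‖ < 1) :
    HasSum (fun i => c i * (e i * w ^ (e i - 1))) (deriv (fun w => ∑' i, c i * w ^ e i) w) := by
  obtain ⟨R, hwR, hR⟩ := exists_between hw
  have h := Complex.hasSum_deriv_of_summable_norm (hs R ((norm_nonneg w).trans hwR.le) hR)
    (fun i => ((differentiable_pow _).const_mul _).differentiableOn) isOpen_ball
    (fun i _ => norm_mul_pow_le_of_mem_ball i) (mem_ball_zero_iff.2 hwR)
  simpa only [deriv_const_mul_field', deriv_pow_field, Pi.smul_apply] using h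

end LacunarySeries

namespace PlaneTree

variable {Δ : Set ℕ} {w : ℂ} {r : ℝ}

/-- The power series `∑ w ^ (δ - 2)` over `δ ∈ Δ`. -/
noncomputable def degreeSeries (Δ : Set ℕ) (w : ℂ) : ℂ := ∑' δ : Δ, w ^ ((δ : ℕ) - 2)

/-- The function `z = w - ∑ w ^ (δ - 1)`, the compositional inverse of the generating function
`w = ∑ T(n) z ^ n` of the trees. -/
noncomputable def inverseSeries (Δ : Set ℕ) (w : ℂ) : ℂ := w * (1 - degreeSeries Δ w)

theorem sub_two_injective (hΔ : ∀ δ ∈ Δ, 3 ≤ δ) : Function.Injective fun δ : Δ => (δ : ℕ) - 2 :=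
  fun δ ε h => by
    have hδ := hΔ δ δ.2
    have hε := hΔ ε ε.2
    exact Subtype.ext (by simp only at h; omega)

theorem summable_pow_sub_two {𝕜 : Type*} [NormedDivisionRing 𝕜] [CompleteSpace 𝕜]
    (hΔ : ∀ δ ∈ Δ, 3 ≤ δ) {x : 𝕜} (hx : ‖x‖ < 1) : Summable fun δ : Δ => x ^ ((δ : ℕ) - 2) :=
  (summable_geometric_of_norm_lt_one hx).comp_injective (sub_two_injective hΔ)

theorem summable_mul_pow_sub_two (hΔ : ∀ δ ∈ Δ, 3 ≤ δ) (hr : 0 ≤ r) (hr1 : r < 1) :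
    Summable fun δ : Δ => ((δ : ℝ) - 1) * r ^ ((δ : ℕ) - 2) := by
  have hnorm : ‖r‖ < 1 := by rwa [Real.norm_of_nonneg hr]
  have h := ((summable_pow_mul_geometric_of_norm_lt_one 1 hnorm).add
    (summable_geometric_of_norm_lt_one hnorm)).comp_injective (sub_two_injective hΔ)
  refine h.congr fun δ => ?_
  simp only [Function.comp_apply, Nat.cast_sub ((Nat.le_succ 2).trans (hΔ δ δ.2))]
  push_cast
  ring

theorem hasSum_degreeSeries (hΔ : ∀ δ ∈ Δ, 3 ≤ δ) (hw : ‖w‖ < 1) :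
    HasSum (fun δ : Δ => w ^ ((δ : ℕ) - 2)) (degreeSeries Δ w) :=
  (summable_pow_sub_two hΔ hw).hasSum

theorem hasSum_pow_sub_one (hΔ : ∀ δ ∈ Δ, 3 ≤ δ) (hw : ‖w‖ < 1) :
    HasSum (fun δ : Δ => w ^ ((δ : ℕ) - 1)) (w - inverseSeries Δ w) := by
  convert! (hasSum_degreeSeries hΔ hw).mul_left w using 1
  · funext δ
    have hδ := hΔ δ δ.2
    rw [← pow_succ', show (δ : ℕ) - 2 + 1 = δ - 1 by omega]
  · rw [inverseSeries]
    ring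

theorem differentiableAt_degreeSeries (hΔ : ∀ δ ∈ Δ, 3 ≤ δ) (hw : ‖w‖ < 1) :
    DifferentiableAt ℂ (degreeSeries Δ) w := by
  have hs : ∀ R : ℝ, 0 ≤ R → R < 1 → Summable fun δ : Δ => ‖(1 : ℂ)‖ * R ^ ((δ : ℕ) - 2) :=
    fun R hR hR1 => by
      simp only [norm_one, one_mul]
      exact (summable_geometric_of_lt_one hR hR1).comp_injective (sub_two_injective hΔ)
  refine (differentiableAt_tsum_mul_pow hs hw).congr_of_eventuallyEq (Eventually.of_forall ?_)
  exact fun v => by simp only [degreeSeries, one_mul]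

theorem differentiableOn_inverseSeries (hΔ : ∀ δ ∈ Δ, 3 ≤ δ) :
    DifferentiableOn ℂ (inverseSeries Δ) (ball 0 1) := fun _ hw =>
  (differentiableAt_id.mul ((differentiableAt_const 1).sub
    (differentiableAt_degreeSeries hΔ (mem_ball_zero_iff.1 hw)))).differentiableWithinAt

theorem hasDerivAt_inverseSeries (hΔ : ∀ δ ∈ Δ, 3 ≤ δ) (hw : ‖w‖ < 1) :
    HasDerivAt (inverseSeries Δ) (deriv (inverseSeries Δ) w) w :=
  ((differentiableOn_inverseSeries hΔ).differentiableAt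
    (isOpen_ball.mem_nhds (mem_ball_zero_iff.2 hw))).hasDerivAt

theorem inverseSeries_eventuallyEq (hΔ : ∀ δ ∈ Δ, 3 ≤ δ) (hw : ‖w‖ < 1) :
    inverseSeries Δ =ᶠ[𝓝 w] fun w => w - ∑' δ : Δ, 1 * w ^ ((δ : ℕ) - 1) := by
  filter_upwards [isOpen_ball.mem_nhds (mem_ball_zero_iff.2 hw)] with v hv
  simp only [one_mul, (hasSum_pow_sub_one hΔ (mem_ball_zero_iff.1 hv)).tsum_eq, sub_sub_cancel]

theorem hasSum_deriv_inverseSeries (hΔ : ∀ δ ∈ Δ, 3 ≤ δ) (hw : ‖w‖ < 1) :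
    HasSum (fun δ : Δ => ((δ : ℂ) - 1) * w ^ ((δ : ℕ) - 2)) (1 - deriv (inverseSeries Δ) w) := by
  have hs : ∀ R : ℝ, 0 ≤ R → R < 1 → Summable fun δ : Δ => ‖(1 : ℂ)‖ * R ^ ((δ : ℕ) - 1) :=
    fun R hR hR1 => by
      simp only [norm_one, one_mul]
      refine (summable_geometric_of_lt_one hR hR1).comp_injective fun δ ε h => ?_
      have hδ := hΔ δ δ.2
      have hε := hΔ ε ε.2
      exact Subtype.ext (by omega)
  rw [(inverseSeries_eventuallyEq hΔ hw).deriv_eq,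
    deriv_fun_sub differentiableAt_fun_id (differentiableAt_tsum_mul_pow hs hw), deriv_id'',
    sub_sub_cancel]
  refine (hasSum_deriv_tsum_mul_pow hs hw).congr_fun fun δ => ?_
  rw [Nat.cast_sub ((by norm_num : 1 ≤ 3).trans (hΔ δ δ.2)), Nat.cast_one, Nat.sub_sub, one_mul]

theorem hasSum_deriv_deriv_inverseSeries (hΔ : ∀ δ ∈ Δ, 3 ≤ δ) (hw : ‖w‖ < 1) :
    HasSum (fun δ : Δ => ((δ : ℂ) - 1) * ((δ : ℂ) - 2) * w ^ ((δ : ℕ) - 3))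
      (-deriv (deriv (inverseSeries Δ)) w) := by
  have hs : ∀ R : ℝ, 0 ≤ R → R < 1 →
      Summable fun δ : Δ => ‖(δ : ℂ) - 1‖ * R ^ ((δ : ℕ) - 2) := fun R hR hR1 => by
    refine (summable_mul_pow_sub_two hΔ hR hR1).congr fun δ => ?_
    have hδ : (1 : ℝ) ≤ δ := by exact_mod_cast (by norm_num : 1 ≤ 3).trans (hΔ δ δ.2)
    rw [← Complex.ofReal_natCast, ← Complex.ofReal_one, ← Complex.ofReal_sub, Complex.norm_real,
      Real.norm_of_nonneg (sub_nonneg.2 hδ)]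
  have heq : deriv (inverseSeries Δ) =ᶠ[𝓝 w]
      fun w => 1 - ∑' δ : Δ, ((δ : ℂ) - 1) * w ^ ((δ : ℕ) - 2) := by
    filter_upwards [isOpen_ball.mem_nhds (mem_ball_zero_iff.2 hw)] with v hv
    rw [(hasSum_deriv_inverseSeries hΔ (mem_ball_zero_iff.1 hv)).tsum_eq, sub_sub_cancel]
  rw [heq.deriv_eq, deriv_const_sub, neg_neg]
  refine (hasSum_deriv_tsum_mul_pow hs hw).congr_fun fun δ => ?_
  rw [Nat.cast_sub ((Nat.le_succ 2).trans (hΔ δ δ.2)), Nat.cast_ofNat, Nat.sub_sub, mul_assoc]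

theorem degreeSeries_zero (hΔ : ∀ δ ∈ Δ, 3 ≤ δ) : degreeSeries Δ 0 = 0 := by
  refine (tsum_congr fun δ => zero_pow ?_).trans tsum_zero
  have hδ := hΔ δ δ.2
  omega

theorem deriv_inverseSeries_zero (hΔ : ∀ δ ∈ Δ, 3 ≤ δ) : deriv (inverseSeries Δ) 0 = 1 := by
  have h := hasSum_deriv_inverseSeries hΔ (w := 0) (by simp)
  have hzero : (fun δ : Δ => ((δ : ℂ) - 1) * 0 ^ ((δ : ℕ) - 2)) = 0 := funext fun δ => by
    have hδ := hΔ δ δ.2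
    rw [zero_pow (by omega), mul_zero, Pi.zero_apply]
  rw [hzero] at h
  exact (sub_eq_zero.1 (h.unique hasSum_zero)).symm

theorem one_sub_degreeSeries_ne_zero (hΔ : ∀ δ ∈ Δ, 3 ≤ δ) (hr1 : r < 1)
    (hS : ∑' δ : Δ, r ^ ((δ : ℕ) - 2) < 1) (hw : ‖w‖ ≤ r) : 1 - degreeSeries Δ w ≠ 0 := by
  have hs : Summable fun δ : Δ => r ^ ((δ : ℕ) - 2) :=
    summable_pow_sub_two hΔ (by rwa [Real.norm_of_nonneg ((norm_nonneg w).trans hw)])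
  have hnorm : ‖degreeSeries Δ w‖ ≤ ∑' δ : Δ, r ^ ((δ : ℕ) - 2) :=
    tsum_of_norm_bounded hs.hasSum fun δ => by rw [norm_pow]; gcongr
  intro h
  rw [← sub_eq_zero.1 h, norm_one] at hnorm
  exact hS.not_ge hnorm

theorem inverseSeries_ne_zero (hΔ : ∀ δ ∈ Δ, 3 ≤ δ) (hr1 : r < 1)
    (hS : ∑' δ : Δ, r ^ ((δ : ℕ) - 2) < 1) (hw : ‖w‖ ≤ r) (hw0 : w ≠ 0) :
    inverseSeries Δ w ≠ 0 :=
  mul_ne_zero hw0 (one_sub_degreeSeries_ne_zero hΔ hr1 hS hw)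

/-- Cauchy's integral over the circle of radius `r` for the coefficient of `z ^ n` in `w ^ k`, where
`w` is the generating function of the trees and `z` is `inverseSeries`. -/
noncomputable def contourCount (Δ : Set ℕ) (r : ℝ) (k n : ℕ) : ℂ :=
  Real.circleAverage
    (fun w => w ^ (k + 1) * deriv (inverseSeries Δ) w / inverseSeries Δ w ^ (n + 1)) 0 r

section Contour

variable (hΔ : ∀ δ ∈ Δ, 3 ≤ δ) (hr : 0 < r) (hr1 : r < 1) (hS : ∑' δ : Δ, r ^ ((δ : ℕ) - 2) < 1)

include hΔ hr hr1 hS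

theorem continuousOn_pow_mul_deriv_div_inverseSeries (k n : ℕ) :
    ContinuousOn (fun w => w ^ k * deriv (inverseSeries Δ) w / inverseSeries Δ w ^ n)
      (sphere 0 r) := by
  have hz := differentiableOn_inverseSeries hΔ
  have hsub : sphere (0 : ℂ) r ⊆ ball 0 1 :=
    sphere_subset_closedBall.trans (closedBall_subset_ball hr1)
  refine (((continuousOn_pow k).mul ((hz.deriv isOpen_ball).continuousOn.mono hsub)).div
    ((hz.continuousOn.mono hsub).pow n)) fun w hw => pow_ne_zero _ ?_
  exact inverseSeries_ne_zero hΔ hr1 hS (mem_sphere_zero_iff_norm.1 hw).le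
    (ne_zero_of_mem_sphere hr.ne' ⟨w, hw⟩)

theorem contourCount_of_le {k n : ℕ} (hnk : n ≤ k) :
    contourCount Δ r k n = if k = n then 1 else 0 := by
  set f : ℂ → ℂ := fun w =>
    w ^ (k - n) * deriv (inverseSeries Δ) w / (1 - degreeSeries Δ w) ^ (n + 1) with hf_def
  have hsub : closedBall (0 : ℂ) r ⊆ ball 0 1 := closedBall_subset_ball hr1
  have hf : DifferentiableOn ℂ f (closedBall 0 r) := by
    refine (((differentiableOn_pow _).mul
      (((differentiableOn_inverseSeries hΔ).deriv isOpen_ball).mono hsub)).div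
      (((differentiableOn_const 1).sub fun w hw => ?_).pow _)) fun w hw => pow_ne_zero _ ?_
    · exact (differentiableAt_degreeSeries hΔ
        (mem_ball_zero_iff.1 (hsub hw))).differentiableWithinAt
    · exact one_sub_degreeSeries_ne_zero hΔ hr1 hS (mem_closedBall_zero_iff.1 hw)
  have hcongr : contourCount Δ r k n = Real.circleAverage f 0 r := by
    refine Real.circleAverage_congr_sphere fun w hw => ?_
    have hw0 : w ≠ 0 := ne_zero_of_mem_sphere (abs_pos.2 hr.ne').ne' ⟨w, hw⟩
    simp only [hf_def, inverseSeries, mul_pow]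
    rw [show k + 1 = (k - n) + (n + 1) by omega, pow_add, mul_assoc, mul_comm (w ^ (n + 1)),
      ← mul_assoc, mul_comm (w ^ (n + 1)), mul_div_mul_right _ _ (pow_ne_zero _ hw0)]
  have hcl : DiffContOnCl ℂ f (ball 0 |r|) := by
    rw [abs_of_pos hr]
    exact DifferentiableOn.diffContOnCl (by rwa [closure_ball _ hr.ne'])
  rw [hcongr, hcl.circleAverage, hf_def]
  simp only [degreeSeries_zero hΔ, deriv_inverseSeries_zero hΔ, sub_zero, one_pow, div_one, mul_one,
    zero_pow_eq]
  exact if_congr (by omega) rfl rfl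

theorem hasDerivAt_pow_div_inverseSeries_pow {w : ℂ} (hw : ‖w‖ = r) (k n : ℕ) :
    HasDerivAt (fun w => w ^ k / inverseSeries Δ w ^ n)
      (k * w ^ (k - 1) / inverseSeries Δ w ^ n -
        n * w ^ k * deriv (inverseSeries Δ) w / inverseSeries Δ w ^ (n + 1)) w := by
  have hz0 := inverseSeries_ne_zero hΔ hr1 hS hw.le (norm_pos_iff.1 (hw ▸ hr))
  have hz := hasDerivAt_inverseSeries hΔ (hw.trans_lt hr1)
  convert! (hasDerivAt_pow k w).div (hz.fun_pow n) (pow_ne_zero n hz0) using 1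
  rcases n with _ | n
  · simp
  · simp only [Nat.add_sub_cancel]
    field_simp
    ring

/-- Integration by parts: the integrands on the two sides differ by `w` times the derivative of
`w ^ k / z ^ n`. -/
theorem mul_contourCount (k n : ℕ) :
    n * contourCount Δ r k n =
      k * Real.circleAverage (fun w => w ^ k / inverseSeries Δ w ^ n) 0 r := by
  set f : ℂ → ℂ := fun w => w ^ k / inverseSeries Δ w ^ n
  set g : ℂ → ℂ := fun w => w ^ (k + 1) * deriv (inverseSeries Δ) w / inverseSeries Δ w ^ (n + 1)
  have hderiv : ∀ w ∈ sphere (0 : ℂ) r, HasDerivAt f _ w := fun w hw =>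
    hasDerivAt_pow_div_inverseSeries_pow hΔ hr hr1 hS (mem_sphere_zero_iff_norm.1 hw) k n
  have hf : CircleIntegrable f 0 r :=
    ContinuousOn.circleIntegrable hr.le fun w hw => (hderiv w hw).continuousAt.continuousWithinAt
  have hg : CircleIntegrable g 0 r :=
    (continuousOn_pow_mul_deriv_div_inverseSeries hΔ hr hr1 hS _ _).circleIntegrable hr.le
  have hparts : Real.circleAverage (fun w => (k : ℂ) • f w - (n : ℂ) • g w) 0 r = 0 := by
    refine (Real.circleAverage_congr_sphere fun w _ => ?_).trans
      (circleAverage_sub_smul_deriv_eq_zero hr hderiv)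
    rcases k with _ | k
    · simp only [f, g, smul_eq_mul, sub_zero, Nat.cast_zero]
      ring
    · simp only [f, g, smul_eq_mul, sub_zero, Nat.add_sub_cancel]
      ring
  rw [Real.circleAverage_fun_sub hf.const_fun_smul hg.const_fun_smul, Real.circleAverage_fun_smul,
    Real.circleAverage_fun_smul, sub_eq_zero] at hparts
  exact hparts.symm

theorem hasSum_contourCount (k n : ℕ) :
    HasSum (fun δ : Δ => contourCount Δ r (k + (δ - 1)) (n + 1))
      (contourCount Δ r (k + 1) (n + 1) - contourCount Δ r k n) := by
  have hcont := continuousOn_pow_mul_deriv_div_inverseSeries hΔ hr hr1 hS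
  obtain ⟨C, hC⟩ := (isCompact_sphere (0 : ℂ) r).exists_bound_of_continuousOn
    (hcont (k + 1) (n + 2))
  rw [contourCount, contourCount, ← Real.circleAverage_fun_sub
    ((hcont (k + 2) (n + 2)).circleIntegrable hr.le)
    ((hcont (k + 1) (n + 1)).circleIntegrable hr.le)]
  have hsummable : Summable fun δ : Δ => C * r ^ ((δ : ℕ) - 1) := by
    refine ((summable_pow_sub_two hΔ (by rwa [Real.norm_of_nonneg hr.le])).mul_left (C * r)).congr
      fun δ => ?_
    have hδ := hΔ δ δ.2
    rw [mul_assoc, ← pow_succ', show (δ : ℕ) - 2 + 1 = δ - 1 by omega]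
  have hfactor (w : ℂ) (j : ℕ) :
      w ^ (k + j + 1) * deriv (inverseSeries Δ) w / inverseSeries Δ w ^ (n + 2) =
        w ^ (k + 1) * deriv (inverseSeries Δ) w / inverseSeries Δ w ^ (n + 2) * w ^ j := by
    ring
  refine hasSum_circleAverage (u := fun δ : Δ => C * r ^ ((δ : ℕ) - 1)) (fun δ => ?_) hsummable
    (fun δ w hw => ?_) fun w hw => ?_ <;> rw [abs_of_pos hr] at *
  · exact hcont _ _
  · rw [hfactor, norm_mul, norm_pow, mem_sphere_zero_iff_norm.1 hw]
    gcongr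
    exact hC w hw
  · rw [mem_sphere_zero_iff_norm] at hw
    have hz0 := inverseSeries_ne_zero hΔ hr1 hS hw.le (norm_pos_iff.1 (hw ▸ hr))
    simp only [hfactor]
    convert! (hasSum_pow_sub_one hΔ (hw.trans_lt hr1)).mul_left _ using 1
    field_simp
    ring

theorem forestCount_eq_contourCount (k n : ℕ) :
    (forestCount Δ k n : ℂ) = contourCount Δ r k n := by
  induction k, n using forest_induction with
  | of_lt k n h =>
    rw [contourCount_of_le hΔ hr hr1 hS h.le, if_neg h.ne', forestCount, forests_eq_empty_of_lt h,
      Set.ncard_empty, Nat.cast_zero]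
  | zero_zero =>
    rw [contourCount_of_le hΔ hr hr1 hS le_rfl, if_pos rfl, forestCount, forests_zero_zero,
      Set.ncard_singleton, Nat.cast_one]
  | zero_succ n =>
    have h := mul_contourCount hΔ hr hr1 hS 0 (n + 1)
    rw [Nat.cast_zero, zero_mul] at h
    rw [(mul_eq_zero_iff_left (Nat.cast_ne_zero.2 n.succ_ne_zero)).1 h, forestCount,
      forests_zero_succ, Set.ncard_empty, Nat.cast_zero]
  | succ_succ k n ihleaf ihgraft =>
    have hcontour := hasSum_contourCount hΔ hr hr1 hS k n
    have hforest := hasSum_forestCount hΔ k n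
    have hterms : (fun δ : Δ => (forestCount Δ (k + (δ - 1)) (n + 1) : ℂ)) =
        fun δ : Δ => contourCount Δ r (k + (δ - 1)) (n + 1) := funext fun δ => by
      have hδ := hΔ δ δ.2
      exact ihgraft _ (by omega)
    rw [hterms, ihleaf] at hforest
    exact sub_left_injective (hforest.unique hcontour)

theorem natCast_mul_forestCount (k n : ℕ) :
    (n * forestCount Δ k n : ℂ) =
      k * Real.circleAverage (fun w => w ^ k / inverseSeries Δ w ^ n) 0 r := by
  rw [forestCount_eq_contourCount hΔ hr hr1 hS, mul_contourCount hΔ hr hr1 hS]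

end Contour

end PlaneTree

open Asymptotics Set

theorem norm_pow_sub_pow_sub_nsmul_le {R : Type*} [NormedCommRing R] [NormOneClass R] {x y : R}
    {M : ℝ} (hx : ‖x‖ ≤ M) (hy : ‖y‖ ≤ M) (k : ℕ) :
    ‖x ^ (k + 2) - y ^ (k + 2) - (k + 2) • (y ^ (k + 1) * (x - y))‖ ≤
      ((k : ℝ) + 2) ^ 2 * ‖x - y‖ ^ 2 * M ^ k := by
  have hM : 0 ≤ M := (norm_nonneg x).trans hx
  induction k with
  | zero =>
    have hsq : x ^ (0 + 2) - y ^ (0 + 2) - (0 + 2) • (y ^ (0 + 1) * (x - y)) = (x - y) ^ 2 := by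
      rw [nsmul_eq_mul]
      push_cast
      ring
    rw [hsq, Nat.cast_zero, pow_zero, mul_one]
    exact (norm_pow_le _ _).trans (le_mul_of_one_le_left (sq_nonneg _) (by norm_num))
  | succ k ih =>
    have hsucc : x ^ (k + 1 + 2) - y ^ (k + 1 + 2) - (k + 1 + 2) • (y ^ (k + 1 + 1) * (x - y)) =
        x * (x ^ (k + 2) - y ^ (k + 2) - (k + 2) • (y ^ (k + 1) * (x - y))) +
          (k + 2) • (y ^ (k + 1) * (x - y) ^ 2) := by
      simp only [nsmul_eq_mul]
      push_cast
      ring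
    have hlast : ‖(k + 2) • (y ^ (k + 1) * (x - y) ^ 2)‖ ≤
        ((k : ℝ) + 2) * (M ^ (k + 1) * ‖x - y‖ ^ 2) := by
      refine (norm_nsmul_le.trans_eq (by push_cast; rfl)).trans ?_
      gcongr
      refine (norm_mul_le _ _).trans ?_
      gcongr
      · exact (norm_pow_le _ _).trans (by gcongr)
      · exact norm_pow_le _ _
    calc _ ≤ M * (((k : ℝ) + 2) ^ 2 * ‖x - y‖ ^ 2 * M ^ k) +
          ((k : ℝ) + 2) * (M ^ (k + 1) * ‖x - y‖ ^ 2) := by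
          rw [hsucc]
          refine (norm_add_le _ _).trans (add_le_add ((norm_mul_le _ _).trans ?_) hlast)
          gcongr
      _ = (((k : ℝ) + 2) ^ 2 + ((k : ℝ) + 2)) * (‖x - y‖ ^ 2 * M ^ (k + 1)) := by ring
      _ ≤ ((k : ℝ) + 1 + 2) ^ 2 * (‖x - y‖ ^ 2 * M ^ (k + 1)) := by
          gcongr
          nlinarith [(Nat.cast_nonneg k : (0 : ℝ) ≤ k)]
      _ = _ := by
          push_cast
          ring

theorem isBigO_principal_of_isBigO_nhdsWithin {X E F : Type*} [TopologicalSpace X]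
    [NormedAddCommGroup E] [NormedAddCommGroup F] {f : X → E} {g : X → F} {s : Set X} {x : X}
    (hs : IsCompact s) (hf : ContinuousOn f s) (hg : ContinuousOn g s)
    (hg0 : ∀ y ∈ s, y ≠ x → g y ≠ 0) (hx : f =O[𝓝[s] x] g) : f =O[𝓟 s] g := by
  refine hs.induction_on (p := fun t => f =O[𝓟 t] g) (by simp) (fun t u htu hu => ?_)
    (fun t u ht hu => ?_) fun y hy => ?_
  · exact hu.mono (principal_mono.2 htu)
  · rw [← sup_principal]
    exact ht.sup hu
  · have hfg : f =O[𝓝[s] y] g := by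
      rcases eq_or_ne y x with rfl | hyx
      · exact hx
      · obtain ⟨c, hc, hcg⟩ := exists_between (norm_pos_iff.2 (hg0 y hy hyx))
        exact ((hf y hy).isBigO_one ℝ).trans ((isBigO_const_left_iff_pos_le_norm one_ne_zero).2
          ⟨c, hc, ((hg y hy).norm.eventually (lt_mem_nhds hcg)).mono fun _ h => h.le⟩)
    obtain ⟨C, hC⟩ := hfg.bound
    exact ⟨_, hC, .of_bound C (eventually_principal.2 fun z hz => hz)⟩

theorem exists_norm_le_exp_neg_mul_sq {B : ℝ → ℂ} {b r : ℝ} (hB : ContinuousOn B (Icc (-r) r))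
    (hb : 0 < b)
    (hB0 : (fun θ : ℝ => B θ - (1 - b / 2 * θ ^ 2)) =o[𝓝 0] fun θ : ℝ => θ ^ 2)
    (hlt : ∀ θ ∈ Icc (-r) r, θ ≠ 0 → ‖B θ‖ < 1) :
    ∃ κ > 0, ∀ θ ∈ Icc (-r) r, ‖B θ‖ ≤ Real.exp (-κ * θ ^ 2) := by
  have hlocal : (fun θ : ℝ => θ ^ 2) =O[𝓝 0] fun θ => 1 - ‖B θ‖ := by
    refine IsBigO.of_bound (4 / b) ?_
    have hsmall : ∀ᶠ θ : ℝ in 𝓝 0, b / 2 * θ ^ 2 < 1 :=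
      ContinuousAt.eventually_lt (by fun_prop) continuousAt_const (by norm_num)
    filter_upwards [hB0.bound (by positivity : 0 < b / 4), hsmall] with θ hθ hθ1
    have hnorm : ‖(1 - b / 2 * θ ^ 2 : ℂ)‖ = 1 - b / 2 * θ ^ 2 := by
      rw [show (1 - b / 2 * θ ^ 2 : ℂ) = (1 - b / 2 * θ ^ 2 : ℝ) by push_cast; rfl,
        Complex.norm_real, Real.norm_of_nonneg (sub_nonneg.2 hθ1.le)]
    have htri := norm_sub_norm_le (B θ) (1 - b / 2 * θ ^ 2)
    rw [Real.norm_of_nonneg (sq_nonneg θ)] at hθ ⊢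
    rw [div_mul_eq_mul_div, le_div_iff₀ hb]
    linarith [Real.le_norm_self (1 - ‖B θ‖)]
  obtain ⟨C, hC, hbound⟩ := (isBigO_principal_of_isBigO_nhdsWithin isCompact_Icc
    (continuous_pow 2).continuousOn (g := fun θ => 1 - ‖B θ‖) (continuousOn_const.sub hB.norm)
    (fun θ hθ h0 => (sub_pos.2 (hlt θ hθ h0)).ne') (hlocal.mono nhdsWithin_le_nhds)).exists_pos
  refine ⟨C⁻¹, inv_pos.2 hC, fun θ hθ => ?_⟩
  have hle := eventually_principal.1 hbound.bound θ hθ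
  have hB1 : ‖B θ‖ ≤ 1 := by
    rcases eq_or_ne θ 0 with rfl | h0
    · have h := hB0.isBigO.eq_zero_imp.self_of_nhds (by simp)
      simpa using (congrArg norm (sub_eq_zero.1 h)).le
    · exact (hlt θ hθ h0).le
  rw [Real.norm_of_nonneg (sq_nonneg θ), Real.norm_of_nonneg (sub_nonneg.2 hB1), mul_comm,
    ← div_le_iff₀ hC] at hle
  calc ‖B θ‖ ≤ -C⁻¹ * θ ^ 2 + 1 := by
        rw [neg_mul, inv_mul_eq_div]
        linarith
    _ ≤ _ := Real.add_one_le_exp _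

theorem norm_mul_pow_sub_le {A B G u v : ℂ} {M : ℝ} (hB : ‖B‖ ≤ M) (hG : ‖G‖ ≤ M) (hM : M ≤ 1)
    (k : ℕ) :
    ‖A * B ^ (k + 2) - G ^ (k + 2) - (u * G ^ (k + 2) + (k + 2) * v * G ^ (k + 1))‖ ≤
      (‖A - 1 - u‖ + (k + 2) * (‖A - 1‖ * ‖v‖ + ‖A‖ * ‖B - G - v‖) +
        (k + 2) ^ 2 * (‖A‖ * ‖B - G‖ ^ 2)) * M ^ k := by
  have hM0 : 0 ≤ M := (norm_nonneg B).trans hB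
  have hGk (j : ℕ) : ‖G ^ (k + j)‖ ≤ M ^ k := by
    rw [norm_pow]
    exact (pow_le_pow_left₀ (norm_nonneg G) hG _).trans
      (pow_le_pow_of_le_one hM0 hM (Nat.le_add_right k j))
  have hk : ‖(k + 2 : ℂ)‖ = k + 2 := by exact_mod_cast Complex.norm_natCast (k + 2)
  have hsplit : A * B ^ (k + 2) - G ^ (k + 2) - (u * G ^ (k + 2) + (k + 2) * v * G ^ (k + 1)) =
      (A - 1 - u) * G ^ (k + 2) +
        (k + 2) * ((A - 1) * v + A * (B - G - v)) * G ^ (k + 1) +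
        A * (B ^ (k + 2) - G ^ (k + 2) - (k + 2) • (G ^ (k + 1) * (B - G))) := by
    rw [nsmul_eq_mul]
    push_cast
    ring
  rw [hsplit, add_mul _ _ (M ^ k), add_mul _ _ (M ^ k)]
  refine norm_add₃_le.trans (add_le_add_three ?_ ?_ ?_)
  · rw [norm_mul]
    gcongr
    exact hGk 2
  · rw [norm_mul, norm_mul, hk]
    gcongr
    · exact (norm_add_le _ _).trans_eq (by rw [norm_mul, norm_mul])
    · exact hGk 1
  · rw [norm_mul]
    refine (mul_le_mul_of_nonneg_left (norm_pow_sub_pow_sub_nsmul_le hB hG k)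
      (norm_nonneg A)).trans_eq ?_
    ring

theorem pow_mul_exp_neg_le {c x : ℝ} (hc : 0 < c) (hx : 0 ≤ x) (n : ℕ) :
    x ^ n * Real.exp (-(2 * c) * x) ≤ n.factorial / c ^ n * Real.exp (-c * x) := by
  have h := Real.pow_div_factorial_le_exp (c * x) (by positivity) n
  rw [div_le_iff₀ (by positivity), mul_pow] at h
  have hsplit : Real.exp (-(2 * c) * x) = Real.exp (-c * x) * Real.exp (-c * x) := by
    rw [← Real.exp_add]
    ring_nf
  have hinv : Real.exp (c * x) * Real.exp (-c * x) = 1 := by rw [← Real.exp_add]; simp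
  rw [hsplit, div_mul_eq_mul_div, le_div_iff₀ (by positivity)]
  calc x ^ n * (Real.exp (-c * x) * Real.exp (-c * x)) * c ^ n
      = (c ^ n * x ^ n) * Real.exp (-c * x) * Real.exp (-c * x) := by ring
    _ ≤ (Real.exp (c * x) * n.factorial) * Real.exp (-c * x) * Real.exp (-c * x) := by gcongr
    _ = n.factorial * Real.exp (-c * x) := by
        rw [mul_right_comm (Real.exp (c * x)), hinv, one_mul]

theorem intervalIntegral_eq_zero_of_odd {E : Type*} [NormedAddCommGroup E] [NormedSpace ℝ E]
    {f : ℝ → E} (hf : f.Odd) (r : ℝ) : ∫ x in -r..r, f x = 0 := by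
  have := IsAddTorsionFree.of_isTorsionFree ℝ E
  have h := intervalIntegral.integral_comp_neg (a := -r) (b := r) f
  simp only [hf _, intervalIntegral.integral_neg, neg_neg] at h
  exact self_eq_neg.1 h.symm

theorem integral_exp_neg_mul_sq_le {c r : ℝ} (hc : 0 < c) (hr : 0 ≤ r) :
    ∫ θ in -r..r, Real.exp (-c * θ ^ 2) ≤ √(Real.pi / c) := by
  rw [← integral_gaussian, intervalIntegral.integral_of_le (neg_le_self hr)]
  exact MeasureTheory.setIntegral_le_integral (integrable_exp_neg_mul_sq hc)
    (Eventually.of_forall fun _ => (Real.exp_pos _).le)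

theorem abs_integral_exp_neg_mul_sq_sub_le {c r : ℝ} (hc : 0 < c) (hr : 0 < r) :
    |(∫ θ in -r..r, Real.exp (-c * θ ^ 2)) - √(Real.pi / c)| ≤
      2 / (c * r ^ 2) * √(2 * Real.pi / c) := by
  have hint := integrable_exp_neg_mul_sq hc
  have hint2 := (integrable_exp_neg_mul_sq (half_pos hc)).const_mul (2 / (c * r ^ 2))
  have hcompl := MeasureTheory.integral_add_compl (measurableSet_Ioc (a := -r) (b := r)) hint
  rw [integral_gaussian, ← intervalIntegral.integral_of_le (neg_le_self hr.le)] at hcompl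
  rw [abs_sub_comm, ← hcompl, add_sub_cancel_left, abs_of_nonneg
    (MeasureTheory.integral_nonneg fun _ => (Real.exp_pos _).le)]
  calc _ ≤ ∫ θ in (Ioc (-r) r)ᶜ, 2 / (c * r ^ 2) * Real.exp (-(c / 2) * θ ^ 2) := by
        refine MeasureTheory.setIntegral_mono_on hint.integrableOn hint2.integrableOn
          measurableSet_Ioc.compl fun θ hθ => ?_
        have hrθ : r ^ 2 ≤ θ ^ 2 := by
          refine sq_le_sq.2 ((abs_of_pos hr).trans_le (le_of_not_gt fun h => hθ ?_))
          exact Ioo_subset_Ioc_self (abs_lt.1 h)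
        have h := pow_mul_exp_neg_le (half_pos hc) (sq_nonneg θ) 1
        rw [pow_one, Nat.factorial_one, Nat.cast_one, pow_one, mul_div_cancel₀ c two_ne_zero,
          one_div_div] at h
        have hle := (mul_le_mul_of_nonneg_right hrθ (Real.exp_pos (-c * θ ^ 2)).le).trans h
        rw [← div_div, div_mul_eq_mul_div, le_div_iff₀ (by positivity), mul_comm]
        exact hle
    _ ≤ ∫ θ, 2 / (c * r ^ 2) * Real.exp (-(c / 2) * θ ^ 2) :=
        MeasureTheory.setIntegral_le_integral hint2
          (Eventually.of_forall fun _ => by positivity)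
    _ = _ := by
        rw [MeasureTheory.integral_const_mul, integral_gaussian]
        rw [div_div_eq_mul_div, mul_comm Real.pi]

theorem isBigO_principal_pow_of_nhds_zero {E : Type*} [NormedAddCommGroup E] {f : ℝ → E}
    {s : Set ℝ} {n : ℕ} (hs : IsCompact s) (hf : ContinuousOn f s)
    (h : f =O[𝓝 0] fun θ : ℝ => θ ^ n) : f =O[𝓟 s] fun θ : ℝ => θ ^ n :=
  isBigO_principal_of_isBigO_nhdsWithin hs hf (continuous_pow n).continuousOn
    (fun _ _ h0 => pow_ne_zero n h0) (h.mono nhdsWithin_le_nhds)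

theorem exp_neg_mul_sq_sub_isBigO (c : ℝ) :
    (fun θ : ℝ => (Real.exp (-c * θ ^ 2) : ℂ) - (1 - c * θ ^ 2)) =O[𝓝 0] fun θ : ℝ => θ ^ 4 := by
  have htendsto : Tendsto (fun θ : ℝ => -c * θ ^ 2) (𝓝 0) (𝓝 0) := by
    simpa using (by fun_prop : Continuous fun θ : ℝ => -c * θ ^ 2).tendsto 0
  have h := (Real.exp_sub_sum_range_isBigO_pow 2).comp_tendsto htendsto
  have hpow : (fun θ : ℝ => (-c * θ ^ 2) ^ 2) =O[𝓝 0] fun θ : ℝ => θ ^ 4 := by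
    simp only [mul_pow, ← pow_mul]
    exact (isBigO_refl _ _).const_mul_left _
  refine .of_norm_left ((h.trans hpow).norm_left.congr_left fun θ => ?_)
  rw [Function.comp_apply, ← Complex.norm_real]
  congr 1
  simp only [Finset.sum_range_succ, Finset.sum_range_zero, Nat.factorial]
  push_cast
  ring

theorem pow_mul_exp_neg_mul_sq_pow_le {κ : ℝ} (hκ : 0 < κ) (θ : ℝ) {k : ℕ} (hk : 1 ≤ k) (i : ℕ) :
    ((k + 2) * θ ^ 2) ^ i * Real.exp (-κ * θ ^ 2) ^ k ≤
      i.factorial / (κ / 6) ^ i * Real.exp (-(κ / 6 * (k + 2)) * θ ^ 2) := by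
  have hk' : (1 : ℝ) ≤ k := by exact_mod_cast hk
  have h := pow_mul_exp_neg_le (by positivity : 0 < κ / 6)
    (by positivity : 0 ≤ ((k : ℝ) + 2) * θ ^ 2) i
  rw [← mul_assoc (-(κ / 6)), neg_mul (κ / 6)] at h
  refine le_trans ?_ h
  rw [← Real.exp_nat_mul]
  refine mul_le_mul_of_nonneg_left (Real.exp_le_exp.2 ?_) (by positivity)
  nlinarith [mul_nonneg (mul_nonneg hκ.le (sq_nonneg θ)) (sub_nonneg.2 hk')]

theorem polynomial_mul_exp_neg_mul_sq_pow_le {κ C₁ C₂ C₃ : ℝ} (hκ : 0 < κ) (hC₁ : 0 ≤ C₁)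
    (hC₂ : 0 ≤ C₂) (hC₃ : 0 ≤ C₃) (θ : ℝ) {k : ℕ} (hk : 1 ≤ k) :
    (C₁ * θ ^ 2 + (k + 2) * (C₂ * θ ^ 4) + (k + 2) ^ 2 * (C₃ * θ ^ 6)) *
        Real.exp (-κ * θ ^ 2) ^ k ≤
      (C₁ * (6 / κ) + C₂ * (2 * (6 / κ) ^ 2) + C₃ * (6 * (6 / κ) ^ 3)) / (k + 2) *
        Real.exp (-(κ / 6 * (k + 2)) * θ ^ 2) := by
  have habsorb := pow_mul_exp_neg_mul_sq_pow_le hκ θ hk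
  rw [div_mul_eq_mul_div, le_div_iff₀ (by positivity)]
  calc _ = C₁ * (((k + 2) * θ ^ 2) ^ 1 * Real.exp (-κ * θ ^ 2) ^ k) +
        C₂ * (((k + 2) * θ ^ 2) ^ 2 * Real.exp (-κ * θ ^ 2) ^ k) +
        C₃ * (((k + 2) * θ ^ 2) ^ 3 * Real.exp (-κ * θ ^ 2) ^ k) := by ring
    _ ≤ _ := add_le_add_three (mul_le_mul_of_nonneg_left (habsorb 1) hC₁)
        (mul_le_mul_of_nonneg_left (habsorb 2) hC₂) (mul_le_mul_of_nonneg_left (habsorb 3) hC₃)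
    _ = _ := by
        simp only [Nat.factorial]
        push_cast
        field_simp

theorem isBigO_mul_ofReal_pow (c : ℂ) (n : ℕ) (l : Filter ℝ) :
    (fun θ : ℝ => c * (θ : ℂ) ^ n) =O[l] fun θ : ℝ => θ ^ n :=
  IsBigO.of_bound ‖c‖ (Eventually.of_forall fun θ => by simp)

theorem exists_remainder_bounds {A B G : ℝ → ℂ} {a c : ℂ} {s : Set ℝ} (hs : IsCompact s)
    (hA : ContinuousOn A s) (hB : ContinuousOn B s) (hG : ContinuousOn G s)
    (hA0 : (fun θ : ℝ => A θ - 1 - a * θ) =O[𝓝 0] fun θ : ℝ => θ ^ 2)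
    (hBG : (fun θ : ℝ => B θ - G θ - c * θ ^ 3) =O[𝓝 0] fun θ : ℝ => θ ^ 4) :
    ∃ C₁ ≥ (0 : ℝ), ∃ C₂ ≥ (0 : ℝ), ∃ C₃ ≥ (0 : ℝ), ∀ θ ∈ s, ‖A θ - 1 - a * θ‖ ≤ C₁ * θ ^ 2 ∧
      ‖A θ - 1‖ * ‖c * (θ : ℂ) ^ 3‖ + ‖A θ‖ * ‖B θ - G θ - c * θ ^ 3‖ ≤ C₂ * θ ^ 4 ∧
      ‖A θ‖ * ‖B θ - G θ‖ ^ 2 ≤ C₃ * θ ^ 6 := by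
  obtain ⟨CA, hCA⟩ := hs.exists_bound_of_continuousOn hA
  have hA2 := isBigO_principal_pow_of_nhds_zero hs (by fun_prop) hA0
  have hBG4 := isBigO_principal_pow_of_nhds_zero hs (by fun_prop) hBG
  have hAone : A =O[𝓟 s] fun _ => (1 : ℝ) :=
    IsBigO.of_bound CA (eventually_principal.2 fun θ hθ => by simpa using hCA θ hθ)
  have hA1 : (fun θ => A θ - 1) =O[𝓟 s] fun θ : ℝ => θ ^ 1 := by
    refine isBigO_principal_pow_of_nhds_zero hs (by fun_prop) ?_
    refine ((hA0.trans (isLittleO_pow_pow one_lt_two).isBigO).add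
      (isBigO_mul_ofReal_pow a 1 (𝓝 0))).congr_left fun θ => ?_
    ring
  have hBG3 : (fun θ => B θ - G θ) =O[𝓟 s] fun θ : ℝ => θ ^ 3 := by
    refine isBigO_principal_pow_of_nhds_zero hs (by fun_prop) ?_
    refine ((hBG.trans (isLittleO_pow_pow (by norm_num)).isBigO).add
      (isBigO_mul_ofReal_pow c 3 (𝓝 0))).congr_left fun θ => ?_
    ring
  obtain ⟨C₁, hC₁, h₁⟩ := hA2.exists_nonneg
  have hAc : (fun θ => ‖A θ - 1‖ * ‖c * (θ : ℂ) ^ 3‖) =O[𝓟 s] fun θ : ℝ => θ ^ 4 :=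
    (hA1.norm_left.mul (isBigO_mul_ofReal_pow c 3 (𝓟 s)).norm_left).congr_right fun θ => by ring
  obtain ⟨C₂, hC₂, h₂⟩ := (hAc.add ((hAone.norm_left.mul hBG4.norm_left).congr_right
    fun θ => one_mul (θ ^ 4))).exists_nonneg
  obtain ⟨C₃, hC₃, h₃⟩ := (hAone.norm_left.mul (hBG3.norm_left.pow 2)).exists_nonneg
  rw [isBigOWith_principal] at h₁ h₂ h₃
  refine ⟨C₁, hC₁, C₂, hC₂, C₃, hC₃, fun θ hθ => ⟨?_, ?_, ?_⟩⟩
  · simpa using h₁ θ hθ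
  · simpa [Even.pow_abs (by decide : Even 4)] using (le_abs_self _).trans (h₂ θ hθ)
  · simpa [← pow_mul, Even.pow_abs (by decide : Even 6)] using h₃ θ hθ

theorem exists_norm_mul_pow_sub_le {A B : ℝ → ℂ} {a c : ℂ} {b r : ℝ}
    (hA : ContinuousOn A (Icc (-r) r)) (hB : ContinuousOn B (Icc (-r) r)) (hb : 0 < b)
    (hA0 : (fun θ : ℝ => A θ - 1 - a * θ) =O[𝓝 0] fun θ : ℝ => θ ^ 2)
    (hB0 : (fun θ : ℝ => B θ - (1 - b / 2 * θ ^ 2 + c * θ ^ 3)) =O[𝓝 0] fun θ : ℝ => θ ^ 4)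
    (hlt : ∀ θ ∈ Icc (-r) r, θ ≠ 0 → ‖B θ‖ < 1) :
    ∃ κ > 0, ∃ K, ∀ k : ℕ, 1 ≤ k → ∀ θ ∈ Icc (-r) r,
      ‖A θ * B θ ^ (k + 2) - Real.exp (-(b / 2) * θ ^ 2) ^ (k + 2) -
        (a * θ * Real.exp (-(b / 2) * θ ^ 2) ^ (k + 2) +
          (k + 2) * (c * θ ^ 3) * Real.exp (-(b / 2) * θ ^ 2) ^ (k + 1))‖ ≤
        K / (k + 2) * Real.exp (-(κ * (k + 2)) * θ ^ 2) := by
  have hBG : (fun θ : ℝ => B θ - Real.exp (-(b / 2) * θ ^ 2) - c * θ ^ 3) =O[𝓝 0]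
      fun θ : ℝ => θ ^ 4 := by
    refine (hB0.sub (exp_neg_mul_sq_sub_isBigO (b / 2))).congr_left fun θ => ?_
    push_cast
    ring
  have hBsq : (fun θ : ℝ => B θ - (1 - b / 2 * θ ^ 2)) =o[𝓝 0] fun θ : ℝ => θ ^ 2 := by
    refine ((hB0.trans_isLittleO (isLittleO_pow_pow (by norm_num))).add
      ((isBigO_mul_ofReal_pow c 3 _).trans_isLittleO
        (isLittleO_pow_pow (by norm_num)))).congr_left fun θ => ?_
    ring
  obtain ⟨C₁, hC₁, C₂, hC₂, C₃, hC₃, hC⟩ :=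
    exists_remainder_bounds isCompact_Icc hA hB (by fun_prop) hA0 hBG
  obtain ⟨κB, hκB, hBκ⟩ := exists_norm_le_exp_neg_mul_sq hB hb hBsq hlt
  set κ := min κB (b / 2)
  have hκ : 0 < κ := lt_min hκB (half_pos hb)
  have hexp {x : ℝ} (hx : κ ≤ x) (θ : ℝ) : Real.exp (-x * θ ^ 2) ≤ Real.exp (-κ * θ ^ 2) := by
    gcongr
  have hG (θ : ℝ) : ‖(Real.exp (-(b / 2) * θ ^ 2) : ℂ)‖ ≤ Real.exp (-κ * θ ^ 2) := by
    rw [Complex.norm_real, Real.norm_of_nonneg (Real.exp_pos _).le]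
    exact hexp (min_le_right _ _) θ
  refine ⟨κ / 6, by positivity, _, fun k hk θ hθ =>
    le_trans ?_ (polynomial_mul_exp_neg_mul_sq_pow_le hκ hC₁ hC₂ hC₃ θ hk)⟩
  obtain ⟨h₁, h₂, h₃⟩ := hC θ hθ
  refine (norm_mul_pow_sub_le ((hBκ θ hθ).trans (hexp (min_le_left _ _) θ)) (hG θ)
    (Real.exp_le_one_iff.2 (by nlinarith [sq_nonneg θ])) k).trans ?_
  gcongr

theorem norm_integral_le_of_norm_le_exp_neg_mul_sq {f : ℝ → ℂ} {C c r : ℝ} (hc : 0 < c)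
    (hr : 0 ≤ r) (hf : ∀ θ ∈ Icc (-r) r, ‖f θ‖ ≤ C * Real.exp (-c * θ ^ 2)) :
    ‖∫ θ in -r..r, f θ‖ ≤ C * √(Real.pi / c) := by
  have hC : 0 ≤ C := by
    simpa using (norm_nonneg (f 0)).trans (hf 0 ⟨neg_nonpos.2 hr, hr⟩)
  calc
    ‖∫ θ in -r..r, f θ‖ ≤ ∫ θ in -r..r, C * Real.exp (-c * θ ^ 2) :=
      intervalIntegral.norm_integral_le_of_norm_le (by linarith)
        (.of_forall fun θ hθ => hf θ (Ioc_subset_Icc_self hθ))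
        (Continuous.intervalIntegrable (by fun_prop) _ _)
    _ ≤ C * √(Real.pi / c) := by
      rw [intervalIntegral.integral_const_mul]
      exact mul_le_mul_of_nonneg_left (integral_exp_neg_mul_sq_le hc hr) hC

theorem norm_integral_sub_sqrt_le_of_odd {f g : ℝ → ℂ} {b κ n r K : ℝ} (hr : 0 < r) (hb : 0 < b)
    (hκ : 0 < κ) (hn : 0 < n) (hf : IntervalIntegrable f MeasureTheory.volume (-r) r)
    (hg : IntervalIntegrable g MeasureTheory.volume (-r) r) (hodd : g.Odd)
    (hfg : ∀ θ ∈ Icc (-r) r, ‖f θ - Real.exp (-(b / 2 * n) * θ ^ 2) - g θ‖ ≤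
      K / n * Real.exp (-(κ * n) * θ ^ 2)) :
    ‖(∫ θ in -r..r, f θ) - (√(2 * Real.pi / (b * n)) : ℝ)‖ ≤
      (K * √(Real.pi / κ) + 4 / (b * r ^ 2) * √(4 * Real.pi / b)) * (1 / (n * √n)) := by
  have hrest := norm_integral_le_of_norm_le_exp_neg_mul_sq (by positivity) hr.le hfg
  have hgauss := abs_integral_exp_neg_mul_sq_sub_le (by positivity : 0 < b / 2 * n) hr
  have hexp : IntervalIntegrable (fun θ : ℝ => (Real.exp (-(b / 2 * n) * θ ^ 2) : ℂ))
      MeasureTheory.volume (-r) r := Continuous.intervalIntegrable (by fun_prop) _ _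
  have hsplit : ∫ θ in -r..r, f θ =
      (∫ θ in -r..r, (f θ - Real.exp (-(b / 2 * n) * θ ^ 2) - g θ)) +
        (∫ θ in -r..r, Real.exp (-(b / 2 * n) * θ ^ 2) : ℝ) := by
    rw [intervalIntegral.integral_sub (hf.sub hexp) hg, intervalIntegral.integral_sub hf hexp,
      intervalIntegral_eq_zero_of_odd hodd, intervalIntegral.integral_ofReal]
    ring
  have hπ : 2 * Real.pi / (b * n) = Real.pi / (b / 2 * n) := by field_simp
  rw [hsplit, add_sub_assoc, ← Complex.ofReal_sub, hπ]
  refine (norm_add_le _ _).trans ((add_le_add hrest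
    ((Complex.norm_real _).trans_le hgauss)).trans_eq ?_)
  rw [show Real.pi / (κ * n) = Real.pi / κ / n by field_simp,
    show 2 * Real.pi / (b / 2 * n) = 4 * Real.pi / b / n by field_simp; norm_num,
    Real.sqrt_div (by positivity) n, Real.sqrt_div (by positivity) n]
  field_simp
  ring

/-- Laplace's method for a complex integrand, with the relative error `O(1 / m)`: the first-order
corrections are odd functions of `θ`, so that they do not contribute to the integral. -/
theorem integral_mul_pow_sub_isBigO {A B : ℝ → ℂ} {a c : ℂ} {b r : ℝ} (hr : 0 < r)
    (hA : ContinuousOn A (Icc (-r) r)) (hB : ContinuousOn B (Icc (-r) r)) (hb : 0 < b)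
    (hA0 : (fun θ : ℝ => A θ - 1 - a * θ) =O[𝓝 0] fun θ : ℝ => θ ^ 2)
    (hB0 : (fun θ : ℝ => B θ - (1 - b / 2 * θ ^ 2 + c * θ ^ 3)) =O[𝓝 0] fun θ : ℝ => θ ^ 4)
    (hlt : ∀ θ ∈ Icc (-r) r, θ ≠ 0 → ‖B θ‖ < 1) :
    (fun m : ℕ => (∫ θ in -r..r, A θ * B θ ^ m) - (√(2 * Real.pi / (b * m)) : ℝ)) =O[atTop]
      fun m : ℕ => 1 / ((m : ℝ) * √m) := by
  obtain ⟨κ, hκ, K, hK⟩ := exists_norm_mul_pow_sub_le hA hB hb hA0 hB0 hlt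
  refine IsBigO.of_bound (K * √(Real.pi / κ) + 4 / (b * r ^ 2) * √(4 * Real.pi / b)) ?_
  filter_upwards [eventually_ge_atTop 3] with m hm
  obtain ⟨k, rfl⟩ := Nat.exists_eq_add_of_le' ((Nat.le_succ 2).trans hm)
  have hGpow (θ : ℝ) : (Real.exp (-(b / 2 * (k + 2 : ℕ)) * θ ^ 2) : ℂ) =
      (Real.exp (-(b / 2) * θ ^ 2) : ℂ) ^ (k + 2) := by
    rw [← Complex.ofReal_pow, ← Real.exp_nat_mul]
    ring_nf
  rw [Real.norm_of_nonneg (by positivity)]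
  refine norm_integral_sub_sqrt_le_of_odd
    (g := fun θ => a * θ * (Real.exp (-(b / 2) * θ ^ 2) : ℂ) ^ (k + 2) +
      (k + 2) * (c * θ ^ 3) * (Real.exp (-(b / 2) * θ ^ 2) : ℂ) ^ (k + 1)) hr hb hκ (by positivity)
    (ContinuousOn.intervalIntegrable_of_Icc (by linarith) (hA.mul (hB.pow _)))
    (Continuous.intervalIntegrable (by fun_prop) _ _) (fun θ => ?_) fun θ hθ => ?_
  · push_cast
    ring_nf
  · rw [hGpow]
    exact_mod_cast hK k (by omega) θ hθ
section SaddlePoint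

theorem isBigO_ofReal_sub_sum_iteratedDeriv {f : ℂ → ℂ} (hf : AnalyticAt ℂ f 0) (n : ℕ) :
    (fun θ : ℝ => f θ - ∑ k ∈ Finset.range n, iteratedDeriv k f 0 / k.factorial * θ ^ k) =O[𝓝 0]
      fun θ : ℝ => θ ^ n := by
  have hreal : Tendsto ((↑) : ℝ → ℂ) (𝓝 0) (𝓝 0) := Complex.continuous_ofReal.tendsto' 0 0 rfl
  refine (((hf.hasFPowerSeriesAt.isBigO_sub_partialSum_pow n).comp_tendsto hreal).congr
    (fun θ => ?_) fun θ => ?_).of_norm_right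
  · simp [FormalMultilinearSeries.partialSum, mul_comm]
  · simp

theorem circleAverage_eq_integral_of_rotation {E : Type*} [NormedAddCommGroup E] [NormedSpace ℝ E]
    {f : ℂ → E} {R : ℝ} {p : ℕ} (hp : p ≠ 0) (hf : ContinuousOn f (sphere 0 |R|))
    (hrot : ∀ w ∈ sphere (0 : ℂ) |R|, f (Complex.exp (2 * Real.pi * Complex.I / p) * w) = f w) :
    Real.circleAverage f 0 R =
      (2 * Real.pi)⁻¹ • ∫ θ in -Real.pi..Real.pi, f (circleMap 0 R (θ / p)) := by
  have hp' : (p : ℝ) ≠ 0 := by exact_mod_cast hp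
  set g : ℝ → E := fun θ => f (circleMap 0 R (θ / p))
  have hg : Continuous g := hf.comp_continuous (by fun_prop) fun θ => circleMap_mem_sphere' 0 R _
  have hperiodic : g.Periodic (2 * Real.pi) := fun θ => by
    simp only [g]
    rw [← hrot _ (circleMap_mem_sphere' 0 R (θ / p))]
    congr 1
    simp only [circleMap, zero_add, mul_left_comm _ (R : ℂ), ← Complex.exp_add]
    push_cast
    ring_nf
  have hshift : ∫ θ in -Real.pi..Real.pi, g θ = ∫ θ in (0 : ℝ)..2 * Real.pi, g θ := by
    simpa [show -Real.pi + 2 * Real.pi = Real.pi by ring] using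
      hperiodic.intervalIntegral_add_eq (-Real.pi) 0
  have hturns := hperiodic.intervalIntegral_add_zsmul_eq (p : ℤ) 0
    fun _ _ => hg.intervalIntegrable _ _
  simp only [zero_add, zsmul_eq_mul, Int.cast_natCast] at hturns
  have hscale := intervalIntegral.integral_comp_mul_left (a := 0) (b := 2 * Real.pi) g hp'
  rw [mul_zero, hturns, natCast_zsmul, ← Nat.cast_smul_eq_nsmul ℝ, inv_smul_smul₀ hp'] at hscale
  rw [Real.circleAverage, hshift, ← hscale]
  simp only [g, mul_div_cancel_left₀ _ hp']

theorem hasDerivAt_mul_exp_mul (a c : ℂ) :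
    HasDerivAt (fun ζ : ℂ => a * Complex.exp (ζ * c)) (a * c) 0 := by
  simpa using (((hasDerivAt_id (0 : ℂ)).mul_const c).cexp).const_mul a

theorem iteratedDeriv_two_comp_mul_exp_mul {f : ℂ → ℂ} {a : ℂ} (hf : AnalyticAt ℂ f a)
    (hf' : deriv f a = 0) (c : ℂ) :
    iteratedDeriv 2 (fun ζ => f (a * Complex.exp (ζ * c))) 0 =
      iteratedDeriv 2 f a * (a * c) ^ 2 := by
  have h := iteratedDeriv_comp_two (g := f) (f := fun ζ : ℂ => a * Complex.exp (ζ * c)) (x := 0)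
    (by simpa using hf.contDiffAt) (by fun_prop)
  simpa [Function.comp_def, hf', (hasDerivAt_mul_exp_mul a c).deriv] using h

theorem isBigO_comp_circleMap_sub_sum {f : ℂ → ℂ} {R : ℝ} (hf : AnalyticAt ℂ f R) (p n : ℕ) :
    (fun θ : ℝ => f (circleMap 0 R (θ / p)) - ∑ k ∈ Finset.range n,
      iteratedDeriv k (fun ζ => f (R * Complex.exp (ζ * (Complex.I / p)))) 0 / k.factorial *
        θ ^ k) =O[𝓝 0] fun θ : ℝ => θ ^ n := by
  have han : AnalyticAt ℂ (fun ζ : ℂ => f (R * Complex.exp (ζ * (Complex.I / p)))) 0 :=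
    AnalyticAt.fun_comp (by simpa using hf) (by fun_prop)
  refine (isBigO_ofReal_sub_sum_iteratedDeriv han n).congr_left fun θ => ?_
  simp only [circleMap, zero_add]
  push_cast
  ring_nf

theorem exists_isBigO_comp_circleMap_sub_linear {f : ℂ → ℂ} {R : ℝ} (hf : AnalyticAt ℂ f R)
    (p : ℕ) : ∃ a : ℂ, (fun θ : ℝ => f (circleMap 0 R (θ / p)) - f R - a * θ) =O[𝓝 0]
      fun θ : ℝ => θ ^ 2 := by
  refine ⟨deriv (fun ζ => f (R * Complex.exp (ζ * (Complex.I / p)))) 0,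
    (isBigO_comp_circleMap_sub_sum hf p 2).congr_left fun θ => ?_⟩
  simp only [Finset.sum_range_succ, Finset.sum_range_zero, iteratedDeriv_zero,
    iteratedDeriv_one, Nat.factorial, zero_mul, Complex.exp_zero, mul_one]
  push_cast
  ring

theorem exists_isBigO_comp_circleMap_sub_cubic {f : ℂ → ℂ} {R : ℝ} (hf : AnalyticAt ℂ f R)
    (hf' : deriv f R = 0) (p : ℕ) :
    ∃ c : ℂ, (fun θ : ℝ => f (circleMap 0 R (θ / p)) -
      (f R - deriv (deriv f) R * (R / p) ^ 2 / 2 * θ ^ 2 + c * θ ^ 3)) =O[𝓝 0]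
        fun θ : ℝ => θ ^ 4 := by
  have hderiv : deriv (fun ζ => f (R * Complex.exp (ζ * (Complex.I / p)))) 0 = 0 := by
    have hf0 : HasDerivAt f 0 (R * Complex.exp (0 * (Complex.I / p))) := by
      simpa [hf'] using hf.differentiableAt.hasDerivAt
    simpa [Function.comp_def] using (hf0.comp 0 (hasDerivAt_mul_exp_mul R (Complex.I / p))).deriv
  have hderiv2 := iteratedDeriv_two_comp_mul_exp_mul hf hf' (Complex.I / p)
  refine ⟨iteratedDeriv 3 (fun ζ => f (R * Complex.exp (ζ * (Complex.I / p)))) 0 / 6,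
    (isBigO_comp_circleMap_sub_sum hf p 4).congr_left fun θ => ?_⟩
  simp only [Finset.sum_range_succ, Finset.sum_range_zero, iteratedDeriv_zero, iteratedDeriv_one,
    hderiv, hderiv2, Nat.factorial, zero_mul, Complex.exp_zero, mul_one]
  rw [iteratedDeriv_succ, iteratedDeriv_one, mul_pow, div_pow, Complex.I_sq]
  push_cast
  ring

theorem circleMap_pow_ne {R : ℝ} (hR : R ≠ 0) {p : ℕ} (hp : p ≠ 0) {θ : ℝ}
    (hθ : θ ∈ Icc (-Real.pi) Real.pi) (hθ0 : θ ≠ 0) : circleMap 0 R (θ / p) ^ p ≠ (R : ℂ) ^ p := by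
  have hp' : (p : ℂ) ≠ 0 := by exact_mod_cast hp
  have hpow : circleMap 0 R (θ / p) ^ p = (R : ℂ) ^ p * Complex.exp (θ * Complex.I) := by
    rw [circleMap, zero_add, mul_pow, ← Complex.exp_nat_mul]
    push_cast
    field_simp
  rw [hpow, Ne, mul_eq_left₀ (pow_ne_zero p (Complex.ofReal_ne_zero.2 hR))]
  intro hexp
  have hcos : Real.cos θ = 1 := by
    rw [← Complex.exp_ofReal_mul_I_re, hexp, Complex.one_re]
  exact hθ0 ((Real.cos_eq_one_iff_of_lt_of_lt (by linarith [hθ.1, Real.pi_pos])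
    (by linarith [hθ.2, Real.pi_pos])).1 hcos)

/-- The saddle-point method on a circle, for an integrand invariant under rotation by `2 * π / p`:
all `p` saddle points contribute equally. -/
theorem circleAverage_mul_pow_sub_isBigO {F H : ℂ → ℂ} {R β : ℝ} {p : ℕ} (hR : 0 < R)
    (hp : p ≠ 0) (hβ : 0 < β) (hF : AnalyticOnNhd ℂ F (sphere 0 R))
    (hH : AnalyticOnNhd ℂ H (sphere 0 R))
    (hFrot : ∀ w ∈ sphere (0 : ℂ) R, F (Complex.exp (2 * Real.pi * Complex.I / p) * w) = F w)
    (hHrot : ∀ w ∈ sphere (0 : ℂ) R, H (Complex.exp (2 * Real.pi * Complex.I / p) * w) = H w)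
    (hF1 : F R = 1) (hH1 : H R = 1) (hH' : deriv H R = 0) (hH'' : deriv (deriv H) R = β)
    (hlt : ∀ w ∈ sphere (0 : ℂ) R, w ^ p ≠ (R : ℂ) ^ p → ‖H w‖ < 1) :
    (fun m : ℕ => 2 * Real.pi * Real.circleAverage (fun w => F w * H w ^ m) 0 R -
      (√(2 * Real.pi / (β * (R / p) ^ 2 * m)) : ℝ)) =O[atTop] fun m : ℕ => 1 / ((m : ℝ) * √m) := by
  have habs : |R| = R := abs_of_pos hR
  have hmem (θ : ℝ) : circleMap 0 R (θ / p) ∈ sphere (0 : ℂ) R := circleMap_mem_sphere 0 hR.le _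
  have hR_mem : (R : ℂ) ∈ sphere (0 : ℂ) R := by simp [habs]
  have hcircle : Continuous fun θ : ℝ => circleMap 0 R (θ / p) := by fun_prop
  obtain ⟨a, hFT⟩ := exists_isBigO_comp_circleMap_sub_linear (hF R hR_mem) p
  obtain ⟨c, hHT⟩ := exists_isBigO_comp_circleMap_sub_cubic (hH R hR_mem) hH' p
  have hlaplace := integral_mul_pow_sub_isBigO Real.pi_pos
    (A := fun θ => F (circleMap 0 R (θ / p))) (B := fun θ => H (circleMap 0 R (θ / p)))
    (b := β * (R / p) ^ 2)
    (hF.continuousOn.comp_continuous hcircle hmem).continuousOn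
    (hH.continuousOn.comp_continuous hcircle hmem).continuousOn (by positivity)
    (hF1 ▸ hFT) (by simpa only [hH1, hH'', Complex.ofReal_mul, Complex.ofReal_pow,
      Complex.ofReal_div, Complex.ofReal_natCast] using hHT)
    fun θ hθ hθ0 => hlt _ (hmem θ) (circleMap_pow_ne hR.ne' hp hθ hθ0)
  refine hlaplace.congr_left fun m => ?_
  rw [circleAverage_eq_integral_of_rotation hp, Complex.real_smul, ← mul_assoc]
  · push_cast
    rw [mul_inv_cancel₀ (by simp [Real.pi_ne_zero]), one_mul]
  · rw [habs]
    exact hF.continuousOn.mul (hH.continuousOn.pow m)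
  · rw [habs]
    exact fun w hw => by rw [hFrot w hw, hHrot w hw]

end SaddlePoint

theorem dvd_of_isGreatest_dvd {α : Type*} {s : Set α} {f : α → ℕ} {p d : ℕ}
    (hp : IsGreatest {d : ℕ | ∀ a ∈ s, d ∣ f a} p) (hd : ∀ a ∈ s, d ∣ f a) : d ∣ p := by
  have hlcm : ∀ a ∈ s, d.lcm p ∣ f a := fun a ha => Nat.lcm_dvd (hd a ha) (hp.1 a ha)
  have hpos : 0 < d.lcm p := Nat.pos_of_ne_zero fun h0 => by
    have hsucc : p + 1 ≤ p := hp.2 fun a ha => by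
      have hfa : f a = 0 := zero_dvd_iff.1 (h0 ▸ hlcm a ha)
      exact hfa ▸ dvd_zero _
    omega
  rw [← le_antisymm (hp.2 hlcm) (Nat.le_of_dvd hpos (Nat.dvd_lcm_right d p))]
  exact Nat.dvd_lcm_left d p

theorem pow_eq_pow_of_isGreatest_dvd {α M₀ : Type*} [CommGroupWithZero M₀] {s : Set α} {f : α → ℕ}
    {p : ℕ} (hp : IsGreatest {d : ℕ | ∀ a ∈ s, d ∣ f a} p) {x y : M₀} (hy : y ≠ 0)
    (hxy : ∀ a ∈ s, x ^ f a = y ^ f a) : x ^ p = y ^ p := by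
  have hone (n : ℕ) : (x / y) ^ n = 1 ↔ x ^ n = y ^ n := by
    rw [div_pow, div_eq_one_iff_eq (pow_ne_zero n hy)]
  rw [← hone, ← orderOf_dvd_iff_pow_eq_one]
  exact dvd_of_isGreatest_dvd hp fun a ha => orderOf_dvd_of_pow_eq_one ((hone _).2 (hxy a ha))

namespace PlaneTree

variable {Δ : Set ℕ} {w : ℂ} {p : ℕ} {τ ρ γ : ℝ}

theorem inverseSeries_mul_of_pow_eq_one (hp : ∀ δ ∈ Δ, p ∣ δ - 2) {ω : ℂ} (hω : ω ^ p = 1)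
    (w : ℂ) : inverseSeries Δ (ω * w) = ω * inverseSeries Δ w := by
  have hdegree : degreeSeries Δ (ω * w) = degreeSeries Δ w := tsum_congr fun δ => by
    obtain ⟨k, hk⟩ := hp δ δ.2
    rw [mul_pow, hk, pow_mul ω, hω, one_pow, one_mul]
  rw [inverseSeries, inverseSeries, hdegree, mul_assoc]

theorem re_degreeSeries_lt (hΔ : ∀ δ ∈ Δ, 3 ≤ δ) (hw : ‖w‖ < 1) {δ : ℕ} (hδ : δ ∈ Δ)
    (hne : w ^ (δ - 2) ≠ (‖w‖ : ℂ) ^ (δ - 2)) :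
    (degreeSeries Δ w).re < (degreeSeries Δ ‖w‖).re := by
  have hnorm : ‖(‖w‖ : ℂ)‖ < 1 := by rwa [Complex.norm_real, norm_norm]
  have hre (n : ℕ) : ((‖w‖ : ℂ) ^ n).re = ‖w ^ n‖ := by
    rw [← Complex.ofReal_pow, Complex.ofReal_re, norm_pow]
  refine hasSum_lt (i := ⟨δ, hδ⟩) (fun ε => ?_) ?_ (Complex.hasSum_re (hasSum_degreeSeries hΔ hw))
    (Complex.hasSum_re (hasSum_degreeSeries hΔ hnorm))
  · rw [hre]
    exact Complex.re_le_norm _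
  · rw [hre]
    refine lt_of_le_of_ne (Complex.re_le_norm _) fun heq => hne ?_
    rw [Complex.eq_coe_norm_of_nonneg (Complex.re_eq_norm.1 heq), norm_pow, Complex.ofReal_pow]

/-- `|1 - h(w)| ≥ 1 - Re h(w)` for `h = degreeSeries Δ`, and the terms of `h(w)` have equal moduli
but not equal arguments. -/
theorem re_inverseSeries_lt_norm (hΔ : ∀ δ ∈ Δ, 3 ≤ δ) (hw : ‖w‖ < 1) (hw0 : w ≠ 0) {δ : ℕ}
    (hδ : δ ∈ Δ) (hne : w ^ (δ - 2) ≠ (‖w‖ : ℂ) ^ (δ - 2)) :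
    (inverseSeries Δ ‖w‖).re < ‖inverseSeries Δ w‖ := by
  rw [inverseSeries, inverseSeries, norm_mul, Complex.re_ofReal_mul]
  gcongr
  calc (1 - degreeSeries Δ ‖w‖).re < (1 - degreeSeries Δ w).re := by
        simpa using re_degreeSeries_lt hΔ hw hδ hne
    _ ≤ ‖1 - degreeSeries Δ w‖ := Complex.re_le_norm _

theorem tsum_pow_sub_two_lt_one (hΔ : ∀ δ ∈ Δ, 3 ≤ δ) (hτ : 0 ≤ τ)
    (h : HasSum (fun δ : Δ => ((δ : ℝ) - 1) * τ ^ ((δ : ℕ) - 2)) 1) :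
    ∑' δ : Δ, τ ^ ((δ : ℕ) - 2) < 1 := by
  have hle : ∀ δ : Δ, τ ^ ((δ : ℕ) - 2) ≤ 1 / 2 * (((δ : ℝ) - 1) * τ ^ ((δ : ℕ) - 2)) := fun δ => by
    have hδ : (3 : ℝ) ≤ δ := by exact_mod_cast hΔ δ δ.2
    have hpow : 0 ≤ τ ^ ((δ : ℕ) - 2) := by positivity
    nlinarith
  have hhalf := h.mul_left (1 / 2)
  have hsummable := Summable.of_nonneg_of_le (fun δ : Δ => by positivity) hle hhalf.summable
  linarith [hasSum_le hle hsummable.hasSum hhalf]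

namespace IsTreeConstants

variable (hΔ : ∀ δ ∈ Δ, 3 ≤ δ) (h : IsTreeConstants Δ τ ρ γ)

include h in
theorem nonempty : Δ.Nonempty := by
  rw [Set.nonempty_iff_ne_empty]
  rintro rfl
  exact zero_ne_one (hasSum_empty.unique h.tau_eq)

include hΔ h

theorem tau_lt_one : τ < 1 := by
  obtain ⟨δ, hδ⟩ := h.nonempty
  have hδ3 : (3 : ℝ) ≤ δ := by exact_mod_cast hΔ δ hδ
  by_contra! hτ
  have hterm := le_hasSum h.tau_eq ⟨δ, hδ⟩ fun ε _ => by
    have hε : (3 : ℝ) ≤ ε := by exact_mod_cast hΔ ε ε.2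
    exact mul_nonneg (by linarith) (by positivity)
  have hpow : 1 ≤ τ ^ (δ - 2) := one_le_pow₀ hτ
  nlinarith

theorem tau_le {τ' ρ' γ' : ℝ} (h' : IsTreeConstants Δ τ' ρ' γ') : τ' ≤ τ := by
  obtain ⟨δ₀, hδ₀⟩ := h.nonempty
  by_contra! hlt
  have hterm : ∀ δ : Δ, ((δ : ℝ) - 1) * τ ^ ((δ : ℕ) - 2) < ((δ : ℝ) - 1) * τ' ^ ((δ : ℕ) - 2) :=
    fun δ => by
      have hδ := hΔ δ δ.2
      have hδ' : (3 : ℝ) ≤ δ := by exact_mod_cast hδ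
      exact mul_lt_mul_of_pos_left (pow_lt_pow_left₀ hlt h.tau_pos.le (by omega)) (by linarith)
  exact (hasSum_lt (fun δ => (hterm δ).le) (hterm ⟨δ₀, hδ₀⟩) h.tau_eq h'.tau_eq).false

theorem unique {τ' ρ' γ' : ℝ} (h' : IsTreeConstants Δ τ' ρ' γ') : τ' = τ ∧ ρ' = ρ ∧ γ' = γ := by
  obtain rfl : τ' = τ := le_antisymm (h.tau_le hΔ h') (h'.tau_le hΔ h)
  obtain ⟨s, hs, rfl⟩ := h.rho_eq
  obtain ⟨s', hs', rfl⟩ := h'.rho_eq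
  obtain ⟨u, hu, rfl⟩ := h.gamma_eq
  obtain ⟨u', hu', rfl⟩ := h'.gamma_eq
  rw [hs.unique hs', hu.unique hu']
  exact ⟨rfl, rfl, rfl⟩

theorem norm_tau_lt_one : ‖(τ : ℂ)‖ < 1 := by
  rw [Complex.norm_of_nonneg h.tau_pos.le]
  exact h.tau_lt_one hΔ

theorem inverseSeries_tau : inverseSeries Δ τ = ρ := by
  obtain ⟨s, hs, hρ⟩ := h.rho_eq
  have hcast := Complex.hasSum_ofReal.2 hs
  push_cast at hcast
  rw [hρ, Complex.ofReal_sub, ← (hasSum_pow_sub_one hΔ (h.norm_tau_lt_one hΔ)).unique hcast,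
    sub_sub_cancel]

theorem deriv_inverseSeries_tau : deriv (inverseSeries Δ) τ = 0 := by
  have hcast := Complex.hasSum_ofReal.2 h.tau_eq
  push_cast at hcast
  exact sub_eq_self.1 ((hasSum_deriv_inverseSeries hΔ (h.norm_tau_lt_one hΔ)).unique hcast)

theorem deriv_deriv_inverseSeries_tau :
    deriv (deriv (inverseSeries Δ)) τ = -(2 * ρ / γ ^ 2 : ℝ) := by
  obtain ⟨s, hs, hγ⟩ := h.gamma_eq
  have hγ_pos := h.gamma_pos
  have hs_eq : s = 2 * ρ / γ ^ 2 := by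
    rw [hγ, Real.sqrt_pos] at hγ_pos
    rw [hγ, Real.sq_sqrt hγ_pos.le, div_div_cancel₀ (mul_pos two_pos h.rho_pos).ne']
  have hcast := Complex.hasSum_ofReal.2 hs
  push_cast at hcast
  rw [← hs_eq,
    ← (hasSum_deriv_deriv_inverseSeries hΔ (h.norm_tau_lt_one hΔ)).unique hcast, neg_neg]

end IsTreeConstants

theorem exists_one_le_mul_pow_sub_two {δ : ℕ} (hδ : 3 ≤ δ) :
    ∃ r ∈ Ioo (0 : ℝ) 1, 1 ≤ ((δ : ℝ) - 1) * r ^ (δ - 2) := by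
  have hδ' : (3 : ℝ) ≤ δ := by exact_mod_cast hδ
  have hcont : ContinuousAt (fun r : ℝ => ((δ : ℝ) - 1) * r ^ (δ - 2)) 1 := by fun_prop
  have hlt : (1 : ℝ) < ((δ : ℝ) - 1) * 1 ^ (δ - 2) := by
    rw [one_pow]
    linarith
  have hev := (hcont.eventually (lt_mem_nhds hlt)).filter_mono
    (nhdsWithin_le_nhds (s := Iio 1))
  obtain ⟨r, hr_large, hr⟩ := (hev.and (Ioo_mem_nhdsLT one_pos)).exists
  exact ⟨r, hr, hr_large.le⟩

theorem exists_hasSum_mul_pow_sub_two_eq_one (hΔ : ∀ δ ∈ Δ, 3 ≤ δ) (hne : Δ.Nonempty) :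
    ∃ τ : ℝ, 0 < τ ∧ τ < 1 ∧ HasSum (fun δ : Δ => ((δ : ℝ) - 1) * τ ^ ((δ : ℕ) - 2)) 1 := by
  obtain ⟨δ₀, hδ₀⟩ := hne
  obtain ⟨r, ⟨hr, hr1⟩, hlarge⟩ := exists_one_le_mul_pow_sub_two (hΔ δ₀ hδ₀)
  have hcoeff : ∀ δ : Δ, 0 ≤ (δ : ℝ) - 1 := fun δ => by
    have hδ : (3 : ℝ) ≤ δ := by exact_mod_cast hΔ δ δ.2
    linarith
  set g : ℝ → ℝ := fun x => ∑' δ : Δ, ((δ : ℝ) - 1) * x ^ ((δ : ℕ) - 2)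
  have hs := summable_mul_pow_sub_two hΔ hr.le hr1
  have hcont : ContinuousOn g (Icc 0 r) :=
    continuousOn_tsum (fun δ => by fun_prop) hs fun δ x hx => by
      rw [norm_mul, norm_pow, Real.norm_of_nonneg (hcoeff δ), Real.norm_of_nonneg hx.1]
      exact mul_le_mul_of_nonneg_left (pow_le_pow_left₀ hx.1 hx.2 _) (hcoeff δ)
  have hg0 : g 0 = 0 := (tsum_congr fun δ => by
    have hδ := hΔ δ δ.2
    rw [zero_pow (by omega), mul_zero]).trans tsum_zero
  have hgr : 1 ≤ g r := hlarge.trans <|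
    le_hasSum hs.hasSum ⟨δ₀, hδ₀⟩ fun δ _ => mul_nonneg (hcoeff δ) (by positivity)
  obtain ⟨τ, ⟨hτ, hτr⟩, hgτ⟩ := intermediate_value_Icc hr.le hcont ⟨hg0.trans_le zero_le_one, hgr⟩
  have hτ0 : τ ≠ 0 := by
    rintro rfl
    exact zero_ne_one (hg0.symm.trans hgτ)
  exact ⟨τ, hτ.lt_of_ne' hτ0, hτr.trans_lt hr1,
    (summable_mul_pow_sub_two hΔ hτ (hτr.trans_lt hr1)).hasSum_iff.2 hgτ⟩

theorem exists_isTreeConstants (hΔ : ∀ δ ∈ Δ, 3 ≤ δ) (hne : Δ.Nonempty) :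
    ∃ τ ρ γ : ℝ, IsTreeConstants Δ τ ρ γ := by
  obtain ⟨τ, hτ, hτ1, hτ_eq⟩ := exists_hasSum_mul_pow_sub_two_eq_one hΔ hne
  have hnorm : ‖τ‖ < 1 := by rwa [Real.norm_of_nonneg hτ.le]
  have hrho : HasSum (fun δ : Δ => τ ^ ((δ : ℕ) - 1)) (τ * ∑' δ : Δ, τ ^ ((δ : ℕ) - 2)) := by
    refine ((summable_pow_sub_two hΔ hnorm).hasSum.mul_left τ).congr_fun fun δ => ?_
    have hδ := hΔ δ δ.2
    rw [← pow_succ', show (δ : ℕ) - 2 + 1 = δ - 1 by omega]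
  have hgamma : Summable fun δ : Δ => ((δ : ℝ) - 1) * ((δ : ℝ) - 2) * τ ^ ((δ : ℕ) - 3) := by
    have hcomplex := (hasSum_deriv_deriv_inverseSeries hΔ (w := τ)
      (by rwa [Complex.norm_real])).summable
    exact_mod_cast hcomplex
  have hterm : ∀ δ : Δ, 0 < ((δ : ℝ) - 1) * ((δ : ℝ) - 2) * τ ^ ((δ : ℕ) - 3) := fun δ => by
    have hδ : (3 : ℝ) ≤ δ := by exact_mod_cast hΔ δ δ.2
    exact mul_pos (mul_pos (by linarith) (by linarith)) (by positivity)
  obtain ⟨δ₀, hδ₀⟩ := hne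
  have hs := hgamma.tsum_pos (fun δ => (hterm δ).le) ⟨δ₀, hδ₀⟩ (hterm _)
  have hρ : 0 < τ - τ * ∑' δ : Δ, τ ^ ((δ : ℕ) - 2) := by
    nlinarith [tsum_pow_sub_two_lt_one hΔ hτ.le hτ_eq]
  exact ⟨τ, _, _, hτ, hρ, Real.sqrt_pos.2 (by positivity), hτ_eq, ⟨_, hrho, rfl⟩,
    ⟨_, hgamma.hasSum, rfl⟩⟩

namespace IsTreeConstants

variable (hΔ : ∀ δ ∈ Δ, 3 ≤ δ) (h : IsTreeConstants Δ τ ρ γ)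

include hΔ h

theorem rho_lt_norm_inverseSeries (hp : IsGreatest {d : ℕ | ∀ δ ∈ Δ, d ∣ δ - 2} p)
    (hw : ‖w‖ = τ) (hwp : w ^ p ≠ (τ : ℂ) ^ p) : ρ < ‖inverseSeries Δ w‖ := by
  obtain ⟨δ, hδ, hne⟩ : ∃ δ ∈ Δ, w ^ (δ - 2) ≠ (τ : ℂ) ^ (δ - 2) := by
    by_contra! hall
    exact hwp (pow_eq_pow_of_isGreatest_dvd hp (Complex.ofReal_ne_zero.2 h.tau_pos.ne') hall)
  have hlt := re_inverseSeries_lt_norm hΔ (hw.trans_lt (h.tau_lt_one hΔ))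
    (norm_pos_iff.1 (hw ▸ h.tau_pos)) hδ (by rwa [hw])
  rwa [hw, h.inverseSeries_tau hΔ, Complex.ofReal_re] at hlt

theorem analyticOnNhd_inverseSeries : AnalyticOnNhd ℂ (inverseSeries Δ) (sphere 0 τ) :=
  ((differentiableOn_inverseSeries hΔ).analyticOnNhd isOpen_ball).mono
    (sphere_subset_closedBall.trans (closedBall_subset_ball (h.tau_lt_one hΔ)))

theorem inverseSeries_ne_zero_of_norm_eq (hw : ‖w‖ = τ) : inverseSeries Δ w ≠ 0 :=
  inverseSeries_ne_zero hΔ (h.tau_lt_one hΔ) (tsum_pow_sub_two_lt_one hΔ h.tau_pos.le h.tau_eq)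
    hw.le (norm_pos_iff.1 (hw ▸ h.tau_pos))

theorem mul_treeCount_eq_circleAverage (n : ℕ) :
    (n * treeCount Δ n : ℂ) = Real.circleAverage (fun w => w / inverseSeries Δ w ^ n) 0 τ := by
  rw [treeCount_eq_forestCount, natCast_mul_forestCount hΔ h.tau_pos (h.tau_lt_one hΔ)
    (tsum_pow_sub_two_lt_one hΔ h.tau_pos.le h.tau_eq)]
  simp only [Nat.cast_one, one_mul, pow_one]

end IsTreeConstants

end PlaneTree

theorem hasDerivAt_div_pow_self {𝕜 : Type*} [NontriviallyNormedField 𝕜] {a : 𝕜} (ha : a ≠ 0)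
    (p : ℕ) : HasDerivAt (fun x => (a / x) ^ p) (-(p / a)) a := by
  convert! ((hasDerivAt_const a a).fun_div (hasDerivAt_id a) ha).fun_pow p using 1
  simp only [id, div_self ha, one_pow]
  field_simp
  ring

theorem deriv_deriv_comp_of_deriv_eq_zero {𝕜 : Type*} [NontriviallyNormedField 𝕜] {φ f : 𝕜 → 𝕜}
    {a : 𝕜} (hφ : ContDiffAt 𝕜 2 φ (f a)) (hf : ContDiffAt 𝕜 2 f a) (hf' : deriv f a = 0) :
    deriv (deriv (φ ∘ f)) a = deriv φ (f a) * deriv (deriv f) a := by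
  have h := iteratedDeriv_comp_two hφ hf
  rwa [hf', sq, mul_zero, mul_zero, zero_add, iteratedDeriv_succ, iteratedDeriv_one,
    iteratedDeriv_succ, iteratedDeriv_one] at h

namespace PlaneTree.IsTreeConstants

variable {Δ : Set ℕ} {p : ℕ} {τ ρ γ : ℝ} (hΔ : ∀ δ ∈ Δ, 3 ≤ δ) (h : IsTreeConstants Δ τ ρ γ)

include hΔ h

theorem deriv_div_inverseSeries_pow (p : ℕ) :
    deriv (fun w => (ρ / inverseSeries Δ w) ^ p) τ = 0 := by
  have hz := hasDerivAt_inverseSeries hΔ (h.norm_tau_lt_one hΔ)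
  have hφ := hasDerivAt_div_pow_self (Complex.ofReal_ne_zero.2 h.rho_pos.ne') p
  rw [h.deriv_inverseSeries_tau hΔ] at hz
  rw [← h.inverseSeries_tau hΔ] at hφ
  simpa [Function.comp_def, h.inverseSeries_tau hΔ] using (hφ.comp _ hz).deriv

theorem deriv_deriv_div_inverseSeries_pow (p : ℕ) :
    deriv (deriv fun w => (ρ / inverseSeries Δ w) ^ p) τ = (2 * p / γ ^ 2 : ℝ) := by
  have hρ : (ρ : ℂ) ≠ 0 := Complex.ofReal_ne_zero.2 h.rho_pos.ne'
  have hz : AnalyticAt ℂ (inverseSeries Δ) τ :=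
    h.analyticOnNhd_inverseSeries hΔ τ (by simp [abs_of_pos h.tau_pos])
  have hφ : ContDiffAt ℂ 2 (fun x => ((ρ : ℂ) / x) ^ p) (inverseSeries Δ τ) := by
    rw [h.inverseSeries_tau hΔ]
    exact (contDiffAt_const.div contDiffAt_id hρ).pow p
  have hcomp := deriv_deriv_comp_of_deriv_eq_zero hφ hz.contDiffAt (h.deriv_inverseSeries_tau hΔ)
  rw [h.inverseSeries_tau hΔ, (hasDerivAt_div_pow_self hρ p).deriv,
    h.deriv_deriv_inverseSeries_tau hΔ] at hcomp
  refine hcomp.trans ?_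
  push_cast
  field_simp

/-- The saddle-point method for `N * T(N) = (2π)⁻¹ ∮ w / z ^ N` with `N = m * p + 1`, the saddle
points being the `p` zeros of `z'` on the circle of radius `τ`. -/
theorem circleAverage_isBigO (hp : IsGreatest {d : ℕ | ∀ δ ∈ Δ, d ∣ δ - 2} p) (hp0 : p ≠ 0) :
    (fun m : ℕ => 2 * Real.pi * Real.circleAverage (fun w =>
        ρ / τ * (w / inverseSeries Δ w) * ((ρ / inverseSeries Δ w) ^ p) ^ m) 0 τ -
      (√(2 * Real.pi / (2 * p / γ ^ 2 * (τ / p) ^ 2 * m)) : ℝ)) =O[atTop]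
        fun m : ℕ => 1 / ((m : ℝ) * √m) := by
  have hτ := Complex.ofReal_ne_zero.2 h.tau_pos.ne'
  have hρ := Complex.ofReal_ne_zero.2 h.rho_pos.ne'
  have hγ := h.gamma_pos
  have hβ : 0 < 2 * p / γ ^ 2 := by positivity
  set ω := Complex.exp (2 * Real.pi * Complex.I / p)
  have hω : ω ^ p = 1 := (Complex.isPrimitiveRoot_exp p hp0).pow_eq_one
  have hω0 : ω ≠ 0 := Complex.exp_ne_zero _
  have hz := h.analyticOnNhd_inverseSeries hΔ
  have hz0 : ∀ w ∈ sphere (0 : ℂ) τ, inverseSeries Δ w ≠ 0 := fun w hw =>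
    h.inverseSeries_ne_zero_of_norm_eq hΔ (mem_sphere_zero_iff_norm.1 hw)
  refine circleAverage_mul_pow_sub_isBigO h.tau_pos hp0 hβ
    (analyticOnNhd_const.mul (analyticOnNhd_id.div hz hz0))
    ((analyticOnNhd_const.div hz hz0).pow p) (fun w _ => ?_) (fun w _ => ?_) ?_ ?_
    (h.deriv_div_inverseSeries_pow hΔ p) (h.deriv_deriv_div_inverseSeries_pow hΔ p)
    fun w hw hwp => ?_
  · rw [inverseSeries_mul_of_pow_eq_one hp.1 hω, mul_div_mul_left _ _ hω0]
  · rw [inverseSeries_mul_of_pow_eq_one hp.1 hω, ← div_div, div_pow, div_pow, div_pow, hω, div_one]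
  · rw [h.inverseSeries_tau hΔ]
    field_simp
  · rw [h.inverseSeries_tau hΔ, div_self hρ, one_pow]
  · rw [mem_sphere_zero_iff_norm] at hw
    rw [norm_pow, norm_div, Complex.norm_of_nonneg h.rho_pos.le]
    have hlt := h.rho_lt_norm_inverseSeries hΔ hp hw hwp
    exact pow_lt_one₀ (div_nonneg h.rho_pos.le (norm_nonneg _))
      ((div_lt_one (h.rho_pos.trans hlt)).2 hlt) hp0

theorem treeCount_isBigO (hp : IsGreatest {d : ℕ | ∀ δ ∈ Δ, d ∣ δ - 2} p) (hp0 : p ≠ 0) :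
    (fun m : ℕ => 2 * Real.pi * ρ ^ (m * p + 1) * ((m * p + 1) * treeCount Δ (m * p + 1)) -
      γ * √(Real.pi * p) / √m) =O[atTop] fun m : ℕ => 1 / ((m : ℝ) * √m) := by
  have hτ := h.tau_pos
  have hγ := h.gamma_pos
  have hmain (m : ℕ) : τ * √(2 * Real.pi / (2 * p / γ ^ 2 * (τ / p) ^ 2 * m)) =
      γ * √(Real.pi * p) / √m := by
    rw [show 2 * Real.pi / (2 * p / γ ^ 2 * (τ / p) ^ 2 * m) = (γ / τ) ^ 2 * (Real.pi * p) / m by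
      field_simp, Real.sqrt_div (by positivity), Real.sqrt_mul (by positivity),
      Real.sqrt_sq (by positivity)]
    field_simp
  have haverage (m : ℕ) : Real.circleAverage (fun w =>
      ρ / τ * (w / inverseSeries Δ w) * ((ρ / inverseSeries Δ w) ^ p) ^ m) 0 τ =
        (ρ ^ (m * p + 1) / τ : ℂ) * ((m * p + 1 : ℕ) * treeCount Δ (m * p + 1)) := by
    rw [h.mul_treeCount_eq_circleAverage hΔ, ← smul_eq_mul, ← Real.circleAverage_fun_smul]
    congr 1
    funext w
    rw [smul_eq_mul, ← pow_mul, div_pow, mul_comm p m, pow_succ, pow_succ]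
    ring
  have hτ0 : (τ : ℂ) ≠ 0 := Complex.ofReal_ne_zero.2 hτ.ne'
  refine ((((h.circleAverage_isBigO hΔ hp hp0).const_mul_left (τ : ℂ)).norm_left).congr_left
    fun m => ?_).of_norm_left
  rw [← hmain, haverage, ← Complex.norm_real]
  congr 1
  push_cast
  field_simp

end PlaneTree.IsTreeConstants

theorem sqrt_mul_add_one_div_sqrt_mul_sqrt_sub_one_isBigO {p : ℕ} (hp : p ≠ 0) :
    (fun m : ℕ => √(m * p + 1) / (√p * √m) - 1) =O[atTop] fun m : ℕ => 1 / (m : ℝ) := by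
  have hp_one : (1 : ℝ) ≤ p := by exact_mod_cast Nat.one_le_iff_ne_zero.2 hp
  refine IsBigO.of_bound 1 ?_
  filter_upwards [eventually_ge_atTop 1] with m hm
  have hm_pos : (0 : ℝ) < m := by exact_mod_cast hm
  have hratio : √(m * p + 1) / (√p * √m) = √(1 + 1 / (m * p)) := by
    rw [← Real.sqrt_mul (by positivity), ← Real.sqrt_div (by positivity)]
    congr 1
    field_simp
  have hlower : 1 ≤ √(1 + 1 / ((m : ℝ) * p)) :=
    Real.one_le_sqrt.2 (le_add_of_nonneg_right (by positivity))
  have hupper : √(1 + 1 / ((m : ℝ) * p)) ≤ 1 + 1 / (m * p) / 2 :=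
    Real.sqrt_one_add_le (neg_one_lt_zero.le.trans (by positivity))
  have hle : 1 / ((m : ℝ) * p) ≤ 1 / m := by
    gcongr
    exact le_mul_of_one_le_right hm_pos.le hp_one
  rw [hratio, Real.norm_of_nonneg (by linarith), Real.norm_of_nonneg (by positivity)]
  linarith [show 0 ≤ 1 / ((m : ℝ) * p) by positivity]

theorem isBigO_sqrt_mul_sub_one_of_isBigO_sub_div_sqrt {J : ℕ → ℝ} {C : ℝ} {p : ℕ} (hC : C ≠ 0)
    (hp : p ≠ 0)
    (hJ : (fun m : ℕ => J m - C / √m) =O[atTop] fun m : ℕ => 1 / ((m : ℝ) * √m)) :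
    (fun m : ℕ => √(m * p + 1) / (C * √p) * J m - 1) =O[atTop] fun m : ℕ => 1 / (m : ℝ) := by
  have hsqrt : (fun m : ℕ => √(m * p + 1)) =O[atTop] fun m : ℕ => √(m : ℝ) := by
    refine IsBigO.of_bound √(p + 1) ?_
    filter_upwards [eventually_ge_atTop 1] with m hm
    have hm_one : (1 : ℝ) ≤ m := by exact_mod_cast hm
    rw [Real.norm_of_nonneg (Real.sqrt_nonneg _), Real.norm_of_nonneg (Real.sqrt_nonneg _),
      ← Real.sqrt_mul (by positivity)]
    exact Real.sqrt_le_sqrt (by linarith)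
  refine (((hsqrt.mul hJ).const_mul_left (C * √p)⁻¹).congr' EventuallyEq.rfl ?_ |>.add
    (sqrt_mul_add_one_div_sqrt_mul_sqrt_sub_one_isBigO hp)).congr' ?_ EventuallyEq.rfl
  · filter_upwards [eventually_ge_atTop 1] with m hm
    field_simp
  · filter_upwards [eventually_ge_atTop 1] with m hm
    field_simp
    ring

namespace PlaneTree.IsTreeConstants

variable {Δ : Set ℕ} {p : ℕ} {τ ρ γ : ℝ} (hΔ : ∀ δ ∈ Δ, 3 ≤ δ) (h : IsTreeConstants Δ τ ρ γ)

include hΔ h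

theorem exists_isBigO_treeCount_eq (hp : IsGreatest {d : ℕ | ∀ δ ∈ Δ, d ∣ δ - 2} p)
    (hp0 : p ≠ 0) :
    ∃ ε : ℕ → ℝ, ε =O[atTop] (fun n : ℕ => 1 / (n : ℝ)) ∧
      ∀ n : ℕ, (treeCount Δ (n * p + 1) : ℝ) =
        p * γ / (2 * √Real.pi) * ((n : ℝ) * p + 1) ^ (-(3 / 2) : ℝ) *
          ρ ^ (-((n : ℤ) * p + 1)) * (1 + ε n) := by
  have hρ := h.rho_pos
  have hγ := h.gamma_pos
  have hp_pos : (0 : ℝ) < p := by exact_mod_cast Nat.pos_of_ne_zero hp0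
  have hC : γ * √(Real.pi * p) ≠ 0 := by positivity
  refine ⟨_, isBigO_sqrt_mul_sub_one_of_isBigO_sub_div_sqrt hC hp0 (h.treeCount_isBigO hΔ hp hp0),
    fun n => ?_⟩
  have hN : (0 : ℝ) < (n : ℝ) * p + 1 := by positivity
  have hz : ρ ^ (-((n : ℤ) * (p : ℤ) + 1)) = (ρ ^ (n * p + 1))⁻¹ := by
    rw [zpow_neg]
    congr 1
  have hr : ((n : ℝ) * p + 1) ^ (-(3 / 2) : ℝ) * √((n : ℝ) * p + 1) = ((n : ℝ) * p + 1)⁻¹ := by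
    rw [Real.sqrt_eq_rpow, ← Real.rpow_add hN, ← Real.rpow_neg_one]
    norm_num
  have hpi : √Real.pi ^ 2 = Real.pi := Real.sq_sqrt Real.pi_pos.le
  have hsp : √(p : ℝ) ^ 2 = p := Real.sq_sqrt hp_pos.le
  rw [hz, add_sub_cancel, Real.sqrt_mul Real.pi_pos.le]
  calc (treeCount Δ (n * p + 1) : ℝ) =
      p / √p ^ 2 * (Real.pi / √Real.pi ^ 2) * ((n * p + 1 : ℝ)⁻¹ * (n * p + 1)) *
        treeCount Δ (n * p + 1) := by
        rw [hsp, hpi]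
        field_simp
    _ = _ := by
        rw [← hr]
        field_simp

end PlaneTree.IsTreeConstants

theorem mainTheorem5 (Δ : Set ℕ) (hΔ : ∀ δ ∈ Δ, 3 ≤ δ) (hne : Δ.Nonempty)
    (p : ℕ) (hp : IsGreatest {d : ℕ | ∀ δ ∈ Δ, d ∣ δ - 2} p) :
    (∀ t : PlaneTree, t.IsLeafRooted → t.IsValent (Δ ∪ {1}) →
      t.numNonRootLeaves ≡ 1 [MOD p]) ∧
    ∃ τ ρ γ : ℝ,
      PlaneTree.IsTreeConstants Δ τ ρ γ ∧
      (∀ τ' ρ' γ' : ℝ, PlaneTree.IsTreeConstants Δ τ' ρ' γ' → τ' = τ ∧ ρ' = ρ ∧ γ' = γ) ∧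
      ∃ ε : ℕ → ℝ, ε =O[Filter.atTop] (fun n : ℕ => 1 / (n : ℝ)) ∧
        ∀ n : ℕ, (PlaneTree.treeCount Δ (n * p + 1) : ℝ) =
          (p : ℝ) * γ / (2 * √Real.pi) * ((n : ℝ) * (p : ℝ) + 1) ^ (-(3 / 2) : ℝ) *
            ρ ^ (-((n : ℤ) * (p : ℤ) + 1)) * (1 + ε n) := by
  have hp0 : p ≠ 0 := Nat.one_le_iff_ne_zero.1 (hp.2 fun _ _ => one_dvd _)
  obtain ⟨τ, ρ, γ, h⟩ := PlaneTree.exists_isTreeConstants hΔ hne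
  exact ⟨fun _ => PlaneTree.numNonRootLeaves_modEq hΔ hp.1, τ, ρ, γ, h,
    fun _ _ _ => h.unique hΔ, h.exists_isBigO_treeCount_eq hΔ hp hp0⟩
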